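/- For $\tau$ in the upper half-plane $\mathcal H$ write $q=e^{2\pi i\tau}$ (and $q^x=e^{2\pi i x\tau}$), $(a;q)_\infty=\prod_{n\ge 0}(1-aq^n)$, let $\eta(\tau)=q^{1/24}(q;q)_\infty$, and for integers $N\ge1$ and $\rho$ with $N\nmid\rho$ let $$f_{N,\rho}(\tau)=q^{\frac{(N-2\rho)^2}{8N}}(q^{\rho};q^N)_\infty(q^{N-\rho};q^N)_\infty(q^N;q^N)_\infty .$$ Let $r_0,r_1,\dots,r_7$ be integers, $R=r_1+r_2+\cdots+r_7$, $S=r_1+r_3+r_5+r_7$, and $$F(\tau)=\eta(98\tau)^{r_0}\prod_{k=1}^{7}f_{98,7k}(\tau)^{r_k}.$$ Suppose that $r_0+R=1$, $r_0+3R\equiv-3\pmod{24}$ and $1+S\equiv0\pmod 4$. Then for every $A=\begin{pmatrix}\alpha&\beta\\ \gamma&\delta\end{pmatrix}\in\Gamma_1(28)\cap\Gamma_0(784)$ and $\tau\in\mathcal H$, $$F(A\tau)=\left(\frac{\gamma}{\delta}\right)\sqrt{\gamma\tau+\delta}\;F(\tau),$$ where the square root is the principal one and, for odd $n$, $\left(\frac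 mn\right)$ is the Jacobi symbol $\left(\frac m{|n|}\right)$, multiplied by $-1$ when both $m<0$ and $n<0$ (so $\left(\frac{0}{\pm1}\right)=1$). In particular $F$ is a weakly holomorphic modular form of weight $\tfrac12$ with theta multiplier on $\Gamma=\Gamma_1(28)\cap\Gamma_0(784)\subseteq\Gamma_0(4)$. That is, $F$ is holomorphic on $\mathcal H$; for all $A\in\Gamma$ it satisfies $F(A\tau)=\left(\frac{\gamma}{\delta}\right)\varepsilon(\delta)^{-1}(\gamma\tau+\delta)^{1/2}F(\tau)$, where $\varepsilon(\delta)=1$ if $\delta\equiv1\pmod4$ and $\varepsilon(\delta)=i$ otherwise; and there is an integer $N\ge1$ with $\Gamma(N)\subseteq\Gamma$ such that for every $B=\begin{pmatrix}a&b\\ c&d\end{pmatrix}\in\mathrm{SL}_2(\mathbb Z)$ the function $(c\tau+d)^{-1/2}F(B\tau)$ has, on $\mathcal H$, a convergent expansion $\sum_{n\ge n_0}a_n e^{2\pi i n\tau/N}$ for some $n_0\in\mathbb Z$ (depending on $B$). -/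

import Mathlib

open UpperHalfPlane CongruenceSubgroup
open scoped MatrixGroups Manifold Real

noncomputable section

namespace EtaQuotient

/-- The power `q ^ x = exp (2 π i x τ)`, where `q = exp (2 π i τ)`. -/
def qPow (x : ℂ) (τ : ℍ) : ℂ := Complex.exp (2 * π * Complex.I * x * (τ : ℂ))

/-- The infinite product `(a; q)_∞ = ∏_{n ≥ 0} (1 - a q ^ n)`. -/
def aqProd (a q : ℂ) : ℂ := ∏' n : ℕ, (1 - a * q ^ n)

/-- The generalized eta function
`f_{N,ρ}(τ) = q ^ ((N - 2ρ)² / (8N)) (q^ρ; q^N)_∞ (q^(N-ρ); q^N)_∞ (q^N; q^N)_∞`. -/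
def genEta (N : ℕ) (ρ : ℤ) (τ : ℍ) : ℂ :=
  qPow (((N : ℂ) - 2 * (ρ : ℂ)) ^ 2 / (8 * (N : ℂ))) τ *
    (aqProd (qPow (ρ : ℂ) τ) (qPow (N : ℂ) τ) *
      aqProd (qPow ((N : ℂ) - (ρ : ℂ)) τ) (qPow (N : ℂ) τ) *
      aqProd (qPow (N : ℂ) τ) (qPow (N : ℂ) τ))

/-- `F(τ) = η(98τ) ^ r₀ ∏_{k=1}^7 f_{98,7k}(τ) ^ r_k`, with `η` the Dedekind eta function. Only the
values `r 0, …, r 7` of the sequence `r` matter. -/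
def etaQuot (r : ℕ → ℤ) (τ : ℍ) : ℂ :=
  ModularForm.eta (98 * (τ : ℂ)) ^ r 0 *
    ∏ k ∈ Finset.Icc (1 : ℕ) 7, genEta 98 (7 * (k : ℤ)) τ ^ r k

/-- The Jacobi symbol `(m / n)` for an integer `m` and an odd integer `n` of either sign:
`(m / |n|)`, with an additional minus sign if both `m` and `n` are negative. In particular
`(0 / ±1) = 1`. -/
def extJacobi (m n : ℤ) : ℤ :=
  if m < 0 ∧ n < 0 then -jacobiSym m n.natAbs else jacobiSym m n.natAbs

/-- `ε(δ)`, for odd `δ`: it is `1` if `δ ≡ 1 (mod 4)` and `i` otherwise. -/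
def thetaEps (δ : ℤ) : ℂ := if δ ≡ 1 [ZMOD 4] then 1 else Complex.I

/-- The factor `(A : τ) = γ τ + δ` for `A = (α, β; γ, δ)`. -/
def autFactor (A : SL(2, ℤ)) (τ : ℍ) : ℂ := ((A 1 0 : ℤ) : ℂ) * (τ : ℂ) + ((A 1 1 : ℤ) : ℂ)

/-- Weakly holomorphic modular forms of half-integral weight `κ / 2` (`κ` odd) on a congruence
subgroup `Γ ⊆ Γ₀(4)`, with the theta multiplier: holomorphic functions on the upper half-plane with
`F(Aτ) = (γ/δ) ^ κ ε(δ) ^ (-κ) (γτ + δ) ^ (κ/2) F(τ)` for `A ∈ Γ` (principal branch), which are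
meromorphic at every cusp. -/
structure IsWeaklyHolomorphicHalfIntegral (κ : ℤ) (Γ : Subgroup SL(2, ℤ)) (F : ℍ → ℂ) : Prop where
  odd_weight : Odd κ
  le_Gamma0_four : Γ ≤ Gamma0 4
  holo : MDifferentiable 𝓘(ℂ) 𝓘(ℂ) F
  transform : ∀ A ∈ Γ, ∀ τ : ℍ,
    F (A • τ) = ((extJacobi (A 1 0) (A 1 1) : ℤ) : ℂ) ^ κ * thetaEps (A 1 1) ^ (-κ) *
      autFactor A τ ^ ((κ : ℂ) / 2) * F τ
  /-- For some `N ≥ 1` with `Γ(N) ⊆ Γ` and every `B ∈ SL₂(ℤ)`, the function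
  `(B : τ) ^ (-κ/2) F(Bτ)` has an expansion `∑_{n ≥ n₀} a_n exp (2 π i n τ / N)`. -/
  cusps : ∃ N : ℕ, 0 < N ∧ Gamma N ≤ Γ ∧ ∀ B : SL(2, ℤ), ∃ (n₀ : ℤ) (a : ℕ → ℂ), ∀ τ : ℍ,
    HasSum (fun n : ℕ ↦ a n * qPow (((n₀ : ℂ) + (n : ℂ)) / (N : ℂ)) τ)
      (autFactor B τ ^ (-((κ : ℂ) / 2)) * F (B • τ))

end EtaQuotient

end

/-! By the Jacobi triple product (`jacobiTheta₂_eq_aqProd`), each `genEta N ρ` is the odd theta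
function at a point of `ℚτ`, evaluated at `Nτ` (`genEta_eq_thetaConst`). The quotient of the odd
theta function by `η ^ 3` transforms under all of `SL₂(ℤ)` with weight -1, index 1/2 and no root of
unity (`thetaTransforms`). Restricting to torsion points leaves an explicit root of unity
(`thetaConst_smul`), so the only nontrivial multiplier needed is that of `η ^ 3` on `Γ₀(4)`. It is
found by Euclidean descent along `T` and `(1, 0; 4, 1)`, where sign changes of the extended Jacobi
symbol match branch changes of the square root (`etaCubeTransforms`).

For `A` in the group put `L = η(98Aτ)/η(98τ)`, `j = γτ + δ`, `u = e(-β/4)` and `x = (γ/δ)`. Then `L³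
= x u⁻¹ j √j`, and the `k`-th theta factor is multiplied by `L³/j`, times `u` when `k` is odd. The
total factor `L^{r₀} (L³/j)^R u^S` collapses to `x √j` exactly because of the three conditions on
the exponents (`etaQuot_smul`).

At the cusps no expansion is computed. Elementary bounds on the products show that `|log ‖F‖|` is at
most a multiple of `y + 1/y` (`controlledGrowth_etaQuot`), so every translate of `F` grows at most
exponentially at `i∞`. It is periodic up to sign, and after multiplication by a power of `q` it has
an ordinary `q`-expansion (`exists_hasSum_of_growth`). -/

noncomputable section

namespace EtaQuotient

section TripleProduct

open Filter Topology Finset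

/-! ### The Jacobi triple product -/

/-- The Gaussian binomial coefficient `[m choose k]_q`. -/
def gaussBinom (q : ℂ) : ℕ → ℕ → ℂ
  | _, 0 => 1
  | 0, _ + 1 => 0
  | m + 1, k + 1 => q ^ (k + 1) * gaussBinom q m (k + 1) + gaussBinom q m k

/-- The finite product `(q; q)_n`. -/
def qFactorial (q : ℂ) (n : ℕ) : ℂ := ∏ i ∈ range n, (1 - q ^ (i + 1))

lemma gaussBinom_zero_right (q : ℂ) (m : ℕ) : gaussBinom q m 0 = 1 := by
  cases m <;> rfl

lemma gaussBinom_succ_succ (q : ℂ) (m k : ℕ) : gaussBinom q (m + 1) (k + 1) =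
    q ^ (k + 1) * gaussBinom q m (k + 1) + gaussBinom q m k := rfl

lemma gaussBinom_eq_zero (q : ℂ) (m k : ℕ) (h : m < k) : gaussBinom q m k = 0 := by
  induction m generalizing k with
  | zero => obtain ⟨k, rfl⟩ := Nat.exists_eq_succ_of_ne_zero h.ne'; rfl
  | succ m ih =>
    obtain ⟨k, rfl⟩ := Nat.exists_eq_succ_of_ne_zero (by omega : k ≠ 0)
    rw [Nat.succ_eq_add_one, gaussBinom_succ_succ, ih _ (by omega), ih _ (by omega)]
    simp

/-- The `q`-binomial theorem. Splitting off the factor `1 + x` and replacing `x` by `xq` in the rest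
reproduces the Pascal rule. -/
lemma prod_one_add_mul_pow (q x : ℂ) (m : ℕ) : ∏ k ∈ range m, (1 + x * q ^ k) =
    ∑ k ∈ range (m + 1), q ^ (k.choose 2) * gaussBinom q m k * x ^ k := by
  induction m generalizing x with
  | zero => simp [gaussBinom_zero_right]
  | succ m ih =>
    rw [prod_range_succ', sum_range_succ']
    have h1 : ∀ k, 1 + x * q ^ (k + 1) = 1 + (x * q) * q ^ k := fun k ↦ by ring
    simp_rw [h1, ih]
    have h2 : ∀ k, q ^ ((k + 1).choose 2) * gaussBinom q (m + 1) (k + 1) * x ^ (k + 1) =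
        q ^ ((k + 1).choose 2) * gaussBinom q m (k + 1) * (x * q) ^ (k + 1) +
        x * (q ^ (k.choose 2) * gaussBinom q m k * (x * q) ^ k) := by
      intro k
      rw [gaussBinom_succ_succ, Nat.choose_succ_succ' k 1]
      simp only [Nat.choose_one_right]
      ring
    simp_rw [h2, sum_add_distrib, ← mul_sum]
    have h3 : ∑ k ∈ range (m + 1), q ^ ((k + 1).choose 2) * gaussBinom q m (k + 1) *
          (x * q) ^ (k + 1) + 1 =
        ∑ k ∈ range (m + 1), q ^ (k.choose 2) * gaussBinom q m k * (x * q) ^ k := by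
      rw [sum_range_succ, gaussBinom_eq_zero q m (m + 1) (by omega),
        sum_range_succ' (fun k ↦ q ^ (k.choose 2) * gaussBinom q m k * (x * q) ^ k)]
      simp [gaussBinom_zero_right]
    rw [← h3]
    simp [gaussBinom_zero_right]
    ring

lemma gaussBinom_mul_qFactorial (q : ℂ) (k l : ℕ) :
    gaussBinom q (k + l) k * qFactorial q k * qFactorial q l = qFactorial q (k + l) := by
  induction h : k + l generalizing k l with
  | zero =>
    obtain ⟨rfl, rfl⟩ : k = 0 ∧ l = 0 := by omega
    simp [qFactorial, gaussBinom_zero_right]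
  | succ n ih =>
    rcases k with _ | k
    · simp only [zero_add] at h
      subst h
      simp [qFactorial, gaussBinom_zero_right]
    rcases l with _ | l
    · have h2 := ih k 0 (by omega)
      obtain rfl : n = k := by omega
      rw [gaussBinom_succ_succ, gaussBinom_eq_zero q n (n + 1) (by omega)]
      simp only [qFactorial, prod_range_succ, range_zero, prod_empty] at h2 ⊢
      linear_combination (1 - q ^ (n + 1)) * h2
    · have h1 := ih (k + 1) l (by omega)
      have h2 := ih k (l + 1) (by omega)
      obtain rfl : n = k + l + 1 := by omega
      rw [gaussBinom_succ_succ]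
      simp only [qFactorial, prod_range_succ] at h1 h2 ⊢
      linear_combination q ^ (k + 1) * (1 - q ^ (l + 1)) * h1 + (1 - q ^ (k + 1)) * h2

lemma qFactorial_ne_zero {q : ℂ} (hq : ‖q‖ < 1) (n : ℕ) : qFactorial q n ≠ 0 := by
  refine prod_ne_zero_iff.mpr fun i _ h ↦ ?_
  have h1 : ‖q ^ (i + 1)‖ < 1 := by
    rw [norm_pow]; exact pow_lt_one₀ (norm_nonneg _) hq (by omega)
  rw [← sub_eq_zero.mp h] at h1
  simp at h1

lemma tendsto_qFactorial {q : ℂ} (hq : ‖q‖ < 1) :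
    Tendsto (qFactorial q) atTop (𝓝 (∏' n : ℕ, (1 - q ^ (n + 1)))) :=
  (ModularForm.multipliable_one_sub_pow hq).hasProd.tendsto_prod_nat

lemma tprod_one_sub_pow_ne_zero {q : ℂ} (hq : ‖q‖ < 1) : ∏' n : ℕ, (1 - q ^ (n + 1)) ≠ 0 := by
  have := tprod_one_add_ne_zero_of_summable (f := fun n : ℕ ↦ -q ^ (n + 1)) (fun i h ↦ ?_) ?_
  · simpa [sub_eq_add_neg] using this
  · have h1 : ‖q ^ (i + 1)‖ < 1 := by
      rw [norm_pow]; exact pow_lt_one₀ (norm_nonneg _) hq (by omega)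
    rw [← sub_eq_add_neg, sub_eq_zero] at h
    rw [← h] at h1
    simp at h1
  · simpa using (summable_nat_add_iff 1).mpr (summable_geometric_of_lt_one (norm_nonneg _) hq)

/-- The central part of the Gaussian binomial coefficients, extended by `0`. -/
def centralGauss (q : ℂ) (n : ℕ) (j : ℤ) : ℂ :=
  if j ∈ Finset.Icc (-(n : ℤ)) n then gaussBinom q (2 * n) (n + j).toNat else 0

lemma centralGauss_eq {q : ℂ} (hq : ‖q‖ < 1) (n : ℕ) (j : ℤ) (h : j ∈ Finset.Icc (-(n : ℤ)) n) :
    centralGauss q n j =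
      qFactorial q (2 * n) * ((qFactorial q (n + j).toNat)⁻¹ * (qFactorial q (n - j).toNat)⁻¹) := by
  rw [centralGauss, if_pos h]
  rw [Finset.mem_Icc] at h
  have h1 := gaussBinom_mul_qFactorial q (n + j).toNat (n - j).toNat
  rw [show (n + j).toNat + (n - j).toNat = 2 * n by omega] at h1
  have := qFactorial_ne_zero hq (n + j).toNat
  have := qFactorial_ne_zero hq (n - j).toNat
  rw [← h1]
  field_simp

/-- All three `q`-factorials tend to `(q; q)_∞`, one in the numerator and two in the denominator. -/
lemma tendsto_centralGauss {q : ℂ} (hq : ‖q‖ < 1) (j : ℤ) :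
    Tendsto (fun n ↦ centralGauss q n j) atTop (𝓝 (∏' n : ℕ, (1 - q ^ (n + 1)))⁻¹) := by
  have h0 := tprod_one_sub_pow_ne_zero hq
  have ht := tendsto_qFactorial hq
  have e1 : Tendsto (fun n : ℕ ↦ 2 * n) atTop atTop :=
    tendsto_atTop.mpr fun b ↦ by filter_upwards [eventually_ge_atTop b] with n hn; omega
  have e2 : Tendsto (fun n : ℕ ↦ (n + j).toNat) atTop atTop :=
    tendsto_atTop.mpr fun b ↦ by
      filter_upwards [eventually_ge_atTop (b + j.natAbs)] with n hn; omega
  have e3 : Tendsto (fun n : ℕ ↦ (n - j).toNat) atTop atTop :=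
    tendsto_atTop.mpr fun b ↦ by
      filter_upwards [eventually_ge_atTop (b + j.natAbs)] with n hn; omega
  have := (ht.comp e1).mul (((ht.comp e2).inv₀ h0).mul ((ht.comp e3).inv₀ h0))
  rw [mul_inv_cancel_left₀ h0] at this
  refine this.congr' ?_
  filter_upwards [eventually_ge_atTop j.natAbs] with n hn
  rw [centralGauss_eq hq]
  · rfl
  · rw [Finset.mem_Icc]; omega

/-- Uniformity in `n` and `j` supplies the dominating series in the triple product limit. -/
lemma exists_norm_centralGauss_le {q : ℂ} (hq : ‖q‖ < 1) : ∃ K, ∀ n j, ‖centralGauss q n j‖ ≤ K := by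
  obtain ⟨K₁, h₁⟩ := (tendsto_qFactorial hq).norm.bddAbove_range
  obtain ⟨K₂, h₂⟩ :=
    ((tendsto_qFactorial hq).inv₀ (tprod_one_sub_pow_ne_zero hq)).norm.bddAbove_range
  have b₁ : ∀ n, ‖qFactorial q n‖ ≤ K₁ := fun n ↦ h₁ ⟨n, rfl⟩
  have b₂ : ∀ n, ‖(qFactorial q n)⁻¹‖ ≤ K₂ := fun n ↦ h₂ ⟨n, rfl⟩
  have p₁ : 0 ≤ K₁ := (norm_nonneg _).trans (b₁ 0)
  have p₂ : 0 ≤ K₂ := (norm_nonneg _).trans (b₂ 0)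
  refine ⟨K₁ * (K₂ * K₂), fun n j ↦ ?_⟩
  by_cases h : j ∈ Finset.Icc (-(n : ℤ)) n
  · rw [centralGauss_eq hq n j h, norm_mul, norm_mul]
    gcongr
    exacts [b₁ _, b₂ _, b₂ _]
  · rw [centralGauss, if_neg h, norm_zero]
    positivity

/-- `exp (2 π i x)`. -/
def e (x : ℂ) : ℂ := Complex.exp (2 * π * Complex.I * x)

lemma e_add (x y : ℂ) : e (x + y) = e x * e y := by
  rw [e, e, e, ← Complex.exp_add, mul_add]

lemma e_neg (x : ℂ) : e (-x) = (e x)⁻¹ := by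
  rw [e, e, ← Complex.exp_neg, mul_neg]

lemma e_ne_zero (x : ℂ) : e x ≠ 0 := Complex.exp_ne_zero _

lemma e_nat_mul (n : ℕ) (x : ℂ) : e (n * x) = e x ^ n := by
  rw [e, e, ← Complex.exp_nat_mul]; congr 1; ring

lemma e_int_mul (n : ℤ) (x : ℂ) : e (n * x) = e x ^ n := by
  rw [e, e, ← Complex.exp_int_mul]; congr 1; ring

lemma e_int (n : ℤ) : e n = 1 := by
  rw [e, ← Complex.exp_int_mul_two_pi_mul_I n]; congr 1; ring

lemma e_half : e (1 / 2) = -1 := by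
  rw [e, ← Complex.exp_pi_mul_I]; congr 1; ring

lemma norm_e (x : ℂ) : ‖e x‖ = Real.exp (-2 * π * x.im) := by
  rw [e, Complex.norm_exp]; congr 1; simp

lemma norm_e_lt_one {τ : ℂ} (hτ : 0 < τ.im) : ‖e τ‖ < 1 := by
  rw [norm_e, Real.exp_lt_one_iff]
  have := mul_pos Real.pi_pos hτ
  nlinarith

lemma prod_neg_mul_pow (z τ : ℂ) (n : ℕ) : ∏ k ∈ range n, (-e (z - k * τ)) =
    e (n * (z + 1 / 2) - (n * (n - 1) / 2) * τ) := by
  induction n with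
  | zero => simp [e]
  | succ n ih =>
    rw [prod_range_succ, ih, ← neg_one_mul, ← e_half, ← e_add, ← e_add]
    congr 1; push_cast; ring

/-- Finite triple product: the `q`-binomial theorem with `2n` factors at `x = -e(z) q^(1-n)`. In the
first half, `1 - e(z - kτ) = -e(z - kτ)(1 - q^k e(-z))`; the extracted monomials cancel after
recentring the sum at `k = n + j`. -/
lemma prod_eq_sum_theta_term (z τ : ℂ) (n : ℕ) :
    ∏ k ∈ range n, ((1 - e τ ^ (k + 1) * e z) * (1 - e τ ^ k * e (-z))) =
      ∑ j ∈ Finset.Icc (-(n : ℤ)) n,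
        jacobiTheta₂_term j (z + τ / 2 + 1 / 2) τ * gaussBinom (e τ) (2 * n) (n + j).toNat := by
  have h1 := prod_one_add_mul_pow (e τ) (e (z + 1 / 2 + (1 - n) * τ)) (n + n)
  rw [prod_range_add] at h1
  have h2 : ∏ k ∈ range n, (1 + e (z + 1 / 2 + (1 - n) * τ) * e τ ^ k) =
      (∏ k ∈ range n, (-e (z - k * τ))) * ∏ k ∈ range n, (1 - e τ ^ k * e (-z)) := by
    rw [← prod_range_reflect, ← prod_mul_distrib]
    refine prod_congr rfl fun k hk ↦ ?_
    have hk' : k + 1 ≤ n := by have := mem_range.mp hk; omega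
    have a1 : e (z + 1 / 2 + (1 - n) * τ) * e τ ^ (n - 1 - k) = -e (z - k * τ) := by
      rw [← e_nat_mul, ← e_add, ← neg_one_mul, ← e_half, ← e_add, Nat.sub_sub,
        Nat.cast_sub (by omega)]
      congr 1; push_cast; ring
    have a2 : e (z - k * τ) * (e τ ^ k * e (-z)) = 1 := by
      rw [← e_nat_mul, ← e_add, ← e_add, ← e_int 0]
      congr 1; push_cast; ring
    rw [a1]
    linear_combination -a2
  have h3 : ∏ k ∈ range n, (1 + e (z + 1 / 2 + (1 - n) * τ) * e τ ^ (n + k)) =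
      ∏ k ∈ range n, (1 - e τ ^ (k + 1) * e z) := by
    refine prod_congr rfl fun k _ ↦ ?_
    have a1 : e (z + 1 / 2 + (1 - n) * τ) * e τ ^ (n + k) = -(e τ ^ (k + 1) * e z) := by
      rw [← e_nat_mul, ← e_nat_mul, ← e_add, ← e_add, ← neg_one_mul, ← e_half, ← e_add]
      congr 1; push_cast; ring
    rw [a1, sub_eq_add_neg]
  rw [h2, h3, prod_neg_mul_pow] at h1
  have h4 : ∑ k ∈ range (n + n + 1), e τ ^ (k.choose 2) * gaussBinom (e τ) (n + n) k *
      e (z + 1 / 2 + (1 - n) * τ) ^ k = e (n * (z + 1 / 2) - (n * (n - 1) / 2) * τ) *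
      ∑ j ∈ Finset.Icc (-(n : ℤ)) n,
        jacobiTheta₂_term j (z + τ / 2 + 1 / 2) τ * gaussBinom (e τ) (2 * n) (n + j).toNat := by
    rw [mul_sum]
    refine sum_bij (fun k _ ↦ (k : ℤ) - n) (fun k hk ↦ ?_) (fun _ _ _ _ h ↦ by omega)
      (fun j hj ↦ ?_) (fun k hk ↦ ?_)
    · rw [mem_range] at hk; rw [Finset.mem_Icc]; omega
    · rw [Finset.mem_Icc] at hj
      exact ⟨(j + n).toNat, by rw [mem_range]; omega, by omega⟩
    · rw [show ((n : ℤ) + ((k : ℤ) - n)).toNat = k by omega, two_mul, ← e_nat_mul, ← e_nat_mul,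
        show jacobiTheta₂_term ((k : ℤ) - n) (z + τ / 2 + 1 / 2) τ =
          e (((k : ℂ) - n) * (z + τ / 2 + 1 / 2) + ((k : ℂ) - n) ^ 2 / 2 * τ) by
            rw [jacobiTheta₂_term, e]; congr 1; push_cast; ring,
        Nat.cast_choose_two, mul_right_comm, ← mul_assoc, ← e_add, ← e_add]
      congr 2
      ring
  rw [h4] at h1
  rw [prod_mul_distrib, ← mul_right_inj' (e_ne_zero (n * (z + 1 / 2) - (n * (n - 1) / 2) * τ)), ← h1]
  ring

lemma multipliable_one_sub_mul_pow (a : ℂ) {q : ℂ} (hq : ‖q‖ < 1) :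
    Multipliable fun n : ℕ ↦ 1 - a * q ^ n := by
  apply multipliable_one_add_of_summable (f := fun n ↦ -(a * q ^ n))
  simpa using (summable_geometric_of_lt_one (norm_nonneg _) hq).mul_left ‖a‖

/-- The Jacobi triple product identity. -/
theorem jacobiTheta₂_eq_aqProd (z : ℂ) {τ : ℂ} (hτ : 0 < τ.im) :
    jacobiTheta₂ (z + τ / 2 + 1 / 2) τ =
      aqProd (e (-z)) (e τ) * aqProd (e (z + τ)) (e τ) * aqProd (e τ) (e τ) := by
  have hq := norm_e_lt_one hτ
  have h0 := tprod_one_sub_pow_ne_zero hq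
  have hE : aqProd (e τ) (e τ) = ∏' n : ℕ, (1 - e τ ^ (n + 1)) := by
    simp only [aqProd, pow_succ']
  have t1 : Tendsto (fun n : ℕ ↦
      ∏ k ∈ range n, ((1 - e τ ^ (k + 1) * e z) * (1 - e τ ^ k * e (-z)))) atTop
      (𝓝 (aqProd (e (z + τ)) (e τ) * aqProd (e (-z)) (e τ))) := by
    have a1 := (multipliable_one_sub_mul_pow (e (z + τ)) hq).hasProd.tendsto_prod_nat
    have a2 := (multipliable_one_sub_mul_pow (e (-z)) hq).hasProd.tendsto_prod_nat
    refine (a1.mul a2).congr fun n ↦ ?_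
    rw [← prod_mul_distrib]
    refine prod_congr rfl fun k _ ↦ ?_
    rw [e_add]
    ring
  obtain ⟨K, hK⟩ := exists_norm_centralGauss_le hq
  have hs := hasSum_jacobiTheta₂_term (z + τ / 2 + 1 / 2) hτ
  -- The theta series converges absolutely and the Gaussian coefficients are bounded by `K`, so the
  -- limit passes inside the sum.
  have t2 := tendsto_tsum_of_dominated_convergence (𝓕 := atTop)
    (f := fun (n : ℕ) (j : ℤ) ↦ jacobiTheta₂_term j (z + τ / 2 + 1 / 2) τ * centralGauss (e τ) n j)
    (hs.summable.norm.mul_right K) (fun j ↦ (tendsto_centralGauss hq j).const_mul _)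
    (Eventually.of_forall fun n j ↦ by
      rw [norm_mul]; exact mul_le_mul_of_nonneg_left (hK n j) (norm_nonneg _))
  have t3 : ∀ n : ℕ, ∑' j : ℤ, jacobiTheta₂_term j (z + τ / 2 + 1 / 2) τ * centralGauss (e τ) n j =
      ∏ k ∈ range n, ((1 - e τ ^ (k + 1) * e z) * (1 - e τ ^ k * e (-z))) := by
    intro n
    rw [prod_eq_sum_theta_term, tsum_eq_sum (s := Finset.Icc (-(n : ℤ)) n)]
    · exact sum_congr rfl fun j hj ↦ by rw [centralGauss, if_pos hj]
    · exact fun j hj ↦ by rw [centralGauss, if_neg hj, mul_zero]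
  simp_rw [t3, tsum_mul_right] at t2
  have := tendsto_nhds_unique t1 t2
  rw [mul_comm (aqProd (e (-z)) (e τ)), this, hE, jacobiTheta₂, inv_mul_cancel_right₀ h0]

end TripleProduct

section OddTheta

open ModularForm (eta)

/-! ### The odd theta function and its modular transformation -/

/-- The odd Jacobi theta function. -/
def oddTheta (z τ : ℂ) : ℂ := e (τ / 8 + z / 2) * jacobiTheta₂ (z + τ / 2 + 1 / 2) τ

lemma oddTheta_add_one (z τ : ℂ) : oddTheta (z + 1) τ = e (1 / 2) * oddTheta z τ := by
  rw [oddTheta, oddTheta, show z + 1 + τ / 2 + 1 / 2 = (z + τ / 2 + 1 / 2) + 1 by ring,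
    jacobiTheta₂_add_left, ← mul_assoc, ← e_add]
  congr 2; ring

lemma oddTheta_add_period (z τ : ℂ) :
    oddTheta (z + τ) τ = e (1 / 2 - τ / 2 - z) * oddTheta z τ := by
  rw [oddTheta, oddTheta, show z + τ + τ / 2 + 1 / 2 = (z + τ / 2 + 1 / 2) + τ by ring,
    jacobiTheta₂_add_left', show -(π : ℂ) * Complex.I * (τ + 2 * (z + τ / 2 + 1 / 2)) =
      2 * π * Complex.I * (-τ - z - 1 / 2) by ring, ← e, ← mul_assoc, ← mul_assoc, ← e_add, ← e_add]
  congr 1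
  rw [show τ / 8 + (z + τ) / 2 + (-τ - z - 1 / 2) =
    (1 / 2 - τ / 2 - z + (τ / 8 + z / 2)) + ((-1 : ℤ) : ℂ) by push_cast; ring, e_add, e_int, mul_one]

lemma oddTheta_add_int (z τ : ℂ) (n : ℤ) : oddTheta (z + n) τ = e (n / 2) * oddTheta z τ := by
  induction n using Int.induction_on with
  | zero => simp [e]
  | succ n ih =>
    push_cast at ih ⊢
    rw [← add_assoc, oddTheta_add_one, ih, ← mul_assoc, ← e_add]
    congr 2; ring
  | pred n ih =>
    push_cast at ih ⊢
    have h := oddTheta_add_one (z + (-n - 1)) τ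
    rw [show z + (-(n : ℂ) - 1) + 1 = z + -n by ring, ih] at h
    rw [← mul_right_inj' (e_ne_zero (1 / 2)), ← h, ← mul_assoc, ← e_add]
    congr 2; ring

lemma oddTheta_add_int_mul (z τ : ℂ) (n : ℤ) :
    oddTheta (z + n * τ) τ = e (n / 2 - n ^ 2 * τ / 2 - n * z) * oddTheta z τ := by
  induction n using Int.induction_on with
  | zero => simp [e]
  | succ n ih =>
    push_cast at ih ⊢
    rw [show z + ((n : ℂ) + 1) * τ = z + n * τ + τ by ring, oddTheta_add_period, ih, ← mul_assoc,
      ← e_add]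
    congr 2; ring
  | pred n ih =>
    push_cast at ih ⊢
    have h := oddTheta_add_period (z + (-n - 1) * τ) τ
    rw [show z + (-(n : ℂ) - 1) * τ + τ = z + -n * τ by ring, ih] at h
    rw [← mul_right_inj' (e_ne_zero (1 / 2 - τ / 2 - (z + (-n - 1) * τ))), ← h, ← mul_assoc, ← e_add]
    congr 2; ring

/-- Since `n² ≡ n (mod 2)`, the factors `exp(π i n²)` and `exp(π i n)` agree. -/
lemma jacobiTheta₂_add_one_right (z τ : ℂ) : jacobiTheta₂ z (τ + 1) = jacobiTheta₂ (z + 1 / 2) τ := by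
  refine tsum_congr fun n ↦ ?_
  obtain ⟨k, hk⟩ := (Int.even_mul_pred_self n).two_dvd
  have hk' : (n : ℂ) ^ 2 = n + 2 * k := by
    have : n ^ 2 = n + 2 * k := by linear_combination hk
    exact_mod_cast this
  rw [jacobiTheta₂_term, jacobiTheta₂_term,
    show 2 * π * Complex.I * n * z + π * Complex.I * n ^ 2 * (τ + 1) =
      (2 * π * Complex.I * n * (z + 1 / 2) + π * Complex.I * n ^ 2 * τ) +
        k * (2 * π * Complex.I) by linear_combination (π * Complex.I : ℂ) * hk',
    Complex.exp_add, Complex.exp_int_mul_two_pi_mul_I, mul_one]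

lemma oddTheta_add_one_right (z τ : ℂ) : oddTheta z (τ + 1) = e (1 / 8) * oddTheta z τ := by
  rw [oddTheta, oddTheta, jacobiTheta₂_add_one_right,
    show z + (τ + 1) / 2 + 1 / 2 + 1 / 2 = (z + τ / 2 + 1 / 2) + 1 by ring,
    jacobiTheta₂_add_left, ← mul_assoc, ← e_add]
  congr 2; ring

lemma eta_add_one (τ : ℂ) : eta (τ + 1) = e (1 / 24) * eta τ := by
  have h : Function.Periodic.qParam 1 (τ + 1) = Function.Periodic.qParam 1 τ := by
    simp [Function.Periodic.qParam, mul_add, Complex.exp_add]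
  simp only [eta, ModularForm.eta_q, h]
  rw [← mul_assoc]
  congr 1
  rw [e, Function.Periodic.qParam, Function.Periodic.qParam, ← Complex.exp_add]
  congr 1
  push_cast
  ring

/-- The arguments of `-i` and `τ` add up inside `(-π/2, π/2)`, so the principal roots multiply
without a sign. -/
lemma eta_neg_inv {τ : ℂ} (hτ : 0 < τ.im) :
    eta (-1 / τ) = (-Complex.I * τ) ^ (1 / 2 : ℂ) * eta τ := by
  have h := ModularForm.eta_comp_eq_csqrt_I_inv hτ
  have hτ0 : τ ≠ 0 := by rintro rfl; simp at hτ
  have h1 := Complex.arg_lt_pi_iff.mpr (Or.inr hτ.ne')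
  have h2 := Complex.arg_nonneg_iff.mpr hτ.le
  have hlog : Complex.log (-Complex.I * τ) = Complex.log (-Complex.I) + Complex.log τ := by
    rw [Complex.log_mul_eq_add_log_iff (by simp) hτ0, Complex.arg_neg_I]
    constructor <;> linarith [Real.pi_pos]
  have h3 : (-Complex.I * τ) ^ (1 / 2 : ℂ) = (Complex.sqrt Complex.I)⁻¹ * Complex.sqrt τ := by
    have hI : Complex.sqrt Complex.I = Complex.I ^ (2⁻¹ : ℂ) := rfl
    have hs : Complex.sqrt τ = τ ^ (2⁻¹ : ℂ) := rfl
    rw [hI, hs, Complex.cpow_def_of_ne_zero (mul_ne_zero (by simp) hτ0),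
      Complex.cpow_def_of_ne_zero Complex.I_ne_zero, Complex.cpow_def_of_ne_zero hτ0,
      ← Complex.exp_neg, ← Complex.exp_add, hlog, Complex.log_neg_I, Complex.log_I]
    congr 1; ring
  rw [h3, mul_assoc]
  simpa using h

lemma cpow_half_sq (x : ℂ) : (x ^ (1 / 2 : ℂ)) ^ 2 = x := by
  rw [one_div]; exact_mod_cast Complex.cpow_nat_inv_pow x two_ne_zero

lemma oddTheta_neg_inv (z : ℂ) {τ : ℂ} (hτ : 0 < τ.im) :
    oddTheta (z / τ) (-1 / τ) =
      -Complex.I * (-Complex.I * τ) ^ (1 / 2 : ℂ) * e (z ^ 2 / (2 * τ)) * oddTheta z τ := by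
  have hτ0 : τ ≠ 0 := by rintro rfl; simp at hτ
  have hs : (-Complex.I * τ) ^ (1 / 2 : ℂ) ≠ 0 := by
    simp [Complex.cpow_eq_zero_iff, hτ0]
  have h := jacobiTheta₂_functional_equation (z + τ / 2 + 1 / 2) τ
  -- The functional equation produces the argument `z/τ + 1/2 + 1/(2τ)`, which is one period `-1/τ`
  -- away from the argument in `oddTheta (z / τ) (-1 / τ)`.
  have h1 := jacobiTheta₂_add_left' (z / τ + -1 / τ / 2 + 1 / 2 + - (-1 / τ) - (-1 / τ) * 0) (-1 / τ)
  have h2 : jacobiTheta₂ ((z + τ / 2 + 1 / 2) / τ) (-1 / τ) = 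
      jacobiTheta₂ (z / τ + -1 / τ / 2 + 1 / 2 + - (-1 / τ)) (-1 / τ) := by
    congr 1; field_simp; ring
  rw [show z / τ + -1 / τ / 2 + 1 / 2 + - (-1 / τ) - (-1 / τ) * 0 + -1 / τ =
    z / τ + -1 / τ / 2 + 1 / 2 by ring, mul_zero, sub_zero, ← h2] at h1
  have hI : e (-1 / 4) = -Complex.I := by
    rw [e, ← Complex.exp_neg_pi_div_two_mul_I]
    congr 1; ring
  rw [oddTheta, oddTheta, h1, h, ← hI]
  set X := jacobiTheta₂ ((z + τ / 2 + 1 / 2) / τ) (-1 / τ)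
  rw [show -(π : ℂ) * Complex.I * (-1 / τ + 2 * (z / τ + -1 / τ / 2 + 1 / 2 + -(-1 / τ))) =
    2 * π * Complex.I * (-(1 / 2) * (-1 / τ + 2 * (z / τ + -1 / τ / 2 + 1 / 2 + -(-1 / τ)))) by ring,
    show -(π : ℂ) * Complex.I * (z + τ / 2 + 1 / 2) ^ 2 / τ =
      2 * π * Complex.I * (-(1 / 2) * (z + τ / 2 + 1 / 2) ^ 2 / τ) by ring, ← e, ← e]
  have key : e (-1 / τ / 8 + z / τ / 2) *
      e (-(1 / 2) * (-1 / τ + 2 * (z / τ + -1 / τ / 2 + 1 / 2 + -(-1 / τ)))) =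
      e (-1 / 4) * e (z ^ 2 / (2 * τ)) * e (τ / 8 + z / 2) *
        e (-(1 / 2) * (z + τ / 2 + 1 / 2) ^ 2 / τ) := by
    rw [← e_add, ← e_add, ← e_add, ← e_add]
    congr 1; field_simp; ring
  rw [hI] at key ⊢
  generalize (-Complex.I * τ) ^ (1 / 2 : ℂ) = s at hs ⊢
  rw [← mul_assoc, key]
  field_simp

/-! ### The automorphy factor and the action of the full modular group. -/

lemma coe_smul_eq (A : SL(2, ℤ)) (τ : ℍ) :
    ((A • τ : ℍ) : ℂ) = ((A 0 0 : ℤ) * (τ : ℂ) + (A 0 1 : ℤ)) / autFactor A τ := by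
  rw [coe_specialLinearGroup_apply]; simp [autFactor]

lemma autFactor_ne_zero (A : SL(2, ℤ)) (τ : ℍ) : autFactor A τ ≠ 0 := by
  simpa [autFactor, denom] using denom_ne_zero (A : GL (Fin 2) ℝ) τ

lemma det_eq_one (A : SL(2, ℤ)) : A 0 0 * A 1 1 - A 0 1 * A 1 0 = 1 := by
  rw [← Matrix.det_fin_two]; exact A.2

lemma autFactor_mul (A B : SL(2, ℤ)) (τ : ℍ) :
    autFactor (A * B) τ = autFactor A (B • τ) * autFactor B τ := by
  have h := autFactor_ne_zero B τ
  rw [autFactor, autFactor, coe_smul_eq]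
  field_simp
  simp [autFactor, Matrix.mul_apply, Fin.sum_univ_two]
  ring

/-- The transformation behaviour of the odd theta function, relative to that of `η ^ 3`. -/
def ThetaTransforms (A : SL(2, ℤ)) : Prop := ∀ (z : ℂ) (τ : ℍ),
  oddTheta (z / autFactor A τ) (A • τ : ℍ) * (eta τ ^ 3 * autFactor A τ) =
    eta (A • τ : ℍ) ^ 3 * e ((A 1 0 : ℤ) * z ^ 2 / (2 * autFactor A τ)) * oddTheta z τ

lemma eta_coe_ne_zero (τ : ℍ) : eta τ ≠ 0 := ModularForm.eta_ne_zero τ.2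

/-- The law is a slash action, so it composes once the exponential factors satisfy the cocycle
relation; this reduces to `c_A + c_B j_A j_B = c_{AB} j_B`. -/
lemma ThetaTransforms.mul {A B : SL(2, ℤ)} (hA : ThetaTransforms A) (hB : ThetaTransforms B) :
    ThetaTransforms (A * B) := by
  intro z τ
  have h1 := hA (z / autFactor B τ) (B • τ)
  have h2 := hB z τ
  have ne1 := autFactor_ne_zero A (B • τ)
  have ne2 := autFactor_ne_zero B τ
  have ne3 := eta_coe_ne_zero (B • τ)
  rw [← mul_smul] at h1
  rw [autFactor_mul, div_mul_eq_div_div_swap]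
  have key : e ((A 1 0 : ℤ) * (z / autFactor B τ) ^ 2 / (2 * autFactor A (B • τ))) *
      e ((B 1 0 : ℤ) * z ^ 2 / (2 * autFactor B τ)) =
      e (((A * B) 1 0 : ℤ) * z ^ 2 / (2 * (autFactor A (B • τ) * autFactor B τ))) := by
    rw [← e_add]
    congr 1
    have a1 := autFactor_mul A B τ
    have a2 := det_eq_one B
    have a3 : ((B 0 0 : ℤ) : ℂ) * (B 1 1 : ℤ) - (B 0 1 : ℤ) * (B 1 0 : ℤ) = 1 := by exact_mod_cast a2
    have a4 : (((A * B) 1 0 : ℤ) : ℂ) =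
        (A 1 0 : ℤ) * (B 0 0 : ℤ) + (A 1 1 : ℤ) * (B 1 0 : ℤ) := by
      simp [Matrix.mul_apply, Fin.sum_univ_two]
    have a5 : (((A * B) 1 1 : ℤ) : ℂ) =
        (A 1 0 : ℤ) * (B 0 1 : ℤ) + (A 1 1 : ℤ) * (B 1 1 : ℤ) := by
      simp [Matrix.mul_apply, Fin.sum_univ_two]
    have a6 : ((A 1 0 : ℤ) : ℂ) + (B 1 0 : ℤ) * (autFactor A (B • τ) * autFactor B τ) =
        (((A * B) 1 0 : ℤ) : ℂ) * autFactor B τ := by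
      rw [← a1, autFactor, autFactor, a4, a5]
      linear_combination -((A 1 0 : ℤ) : ℂ) * a3
    field_simp
    linear_combination z ^ 2 * a6
  rw [← key]
  refine mul_left_cancel₀ (pow_ne_zero 3 ne3) ?_
  linear_combination (eta (τ : ℂ) ^ 3 * autFactor B τ) * h1 +
    eta ((A * B) • τ : ℍ) ^ 3 *
      e ((A 1 0 : ℤ) * (z / autFactor B τ) ^ 2 / (2 * autFactor A (B • τ))) * h2

lemma ThetaTransforms.inv {A : SL(2, ℤ)} (hA : ThetaTransforms A) : ThetaTransforms A⁻¹ := by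
  intro z τ
  have h0 : autFactor A (A⁻¹ • τ) * autFactor A⁻¹ τ = 1 := by
    rw [← autFactor_mul, mul_inv_cancel]; simp [autFactor]
  have h1 := hA (z * autFactor A (A⁻¹ • τ)) (A⁻¹ • τ)
  have ne1 := autFactor_ne_zero A (A⁻¹ • τ)
  rw [smul_inv_smul, mul_div_cancel_right₀ _ ne1] at h1
  have h2 : autFactor A⁻¹ τ = (autFactor A (A⁻¹ • τ))⁻¹ := eq_inv_of_mul_eq_one_right h0
  rw [h2, div_inv_eq_mul]
  have h3 : (A⁻¹ 1 0 : ℤ) = -A 1 0 := by simp [Matrix.SpecialLinearGroup.SL2_inv_expl]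
  rw [h3]
  have key : e (((-A 1 0 : ℤ) : ℂ) * z ^ 2 / (2 * (autFactor A (A⁻¹ • τ))⁻¹)) *
      e ((A 1 0 : ℤ) * (z * autFactor A (A⁻¹ • τ)) ^ 2 / (2 * autFactor A (A⁻¹ • τ))) = 1 := by
    rw [← e_add, ← e_int 0]
    congr 1
    push_cast
    field_simp
    ring
  have k2 : autFactor A (A⁻¹ • τ) * (autFactor A (A⁻¹ • τ))⁻¹ = 1 := mul_inv_cancel₀ ne1
  linear_combination -(autFactor A (A⁻¹ • τ))⁻¹ *
      e (((-A 1 0 : ℤ) : ℂ) * z ^ 2 / (2 * (autFactor A (A⁻¹ • τ))⁻¹)) * h1 -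
    oddTheta (z * autFactor A (A⁻¹ • τ)) (A⁻¹ • τ : ℍ) * eta τ ^ 3 *
      (autFactor A (A⁻¹ • τ))⁻¹ * key +
    e (((-A 1 0 : ℤ) : ℂ) * z ^ 2 / (2 * (autFactor A (A⁻¹ • τ))⁻¹)) *
      oddTheta z τ * eta (A⁻¹ • τ : ℍ) ^ 3 * k2

lemma thetaTransforms_T : ThetaTransforms ModularGroup.T := by
  intro z τ
  have h0 : autFactor ModularGroup.T τ = 1 := by simp [autFactor, ModularGroup.T]
  have h1 : ((ModularGroup.T • τ : ℍ) : ℂ) = τ + 1 := by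
    rw [modular_T_smul, coe_vadd]; push_cast; ring
  have h2 : ModularGroup.T 1 0 = 0 := by simp [ModularGroup.T]
  have h3 : e (1 / 8) = e (1 / 24) ^ 3 := by
    rw [← e_nat_mul]; congr 1; norm_num
  have h4 : e 0 = 1 := by simp [e]
  rw [h0, h1, h2, eta_add_one, div_one, oddTheta_add_one_right, h3]
  simp only [Int.cast_zero, zero_mul, zero_div, h4]
  ring

/-- With `s = (-iτ)^(1/2)`, theta contributes `-is` and `η ^ 3` contributes `s³`; the two agree
because `-isτ = s³`. -/
lemma thetaTransforms_S : ThetaTransforms ModularGroup.S := by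
  intro z τ
  have h0 : autFactor ModularGroup.S τ = τ := by simp [autFactor, ModularGroup.S]
  have h1 : ((ModularGroup.S • τ : ℍ) : ℂ) = -1 / τ := by
    rw [modular_S_smul]; simp [neg_div]
  have h2 : ModularGroup.S 1 0 = 1 := by simp [ModularGroup.S]
  rw [h0, h1, h2, oddTheta_neg_inv z τ.2, eta_neg_inv τ.2, Int.cast_one, one_mul]
  linear_combination -(e (z ^ 2 / (2 * τ)) * oddTheta z τ * eta τ ^ 3 *
    (-Complex.I * τ) ^ (1 / 2 : ℂ)) * cpow_half_sq (-Complex.I * τ)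

theorem thetaTransforms (A : SL(2, ℤ)) : ThetaTransforms A := by
  have hA : A ∈ Subgroup.closure {ModularGroup.S, ModularGroup.T} := by
    rw [_root_.SpecialLinearGroup.SL2Z_generators]; trivial
  induction hA using Subgroup.closure_induction with
  | mem x hx =>
    rcases hx with rfl | rfl
    exacts [thetaTransforms_S, thetaTransforms_T]
  | one =>
    intro z τ
    simp [autFactor, e]
    ring
  | mul x y _ _ hx hy => exact hx.mul hy
  | inv x _ hx => exact hx.inv

/-- The theta constant with real characteristic `x`. -/
def thetaConst (x : ℂ) (τ : ℂ) : ℂ := e (x ^ 2 / 2 * τ) * oddTheta (-x * τ) τ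

/-- Taking `z = -x(aτ + b)` in the theta law gives `z/(cτ + d) = -x·Aτ`. The hypotheses make `z`
congruent to `-xτ` modulo `ℤτ + ℤ`, and quasi-periodicity leaves only a root of unity. -/
lemma thetaConst_smul (A : SL(2, ℤ)) (x : ℂ) (m B : ℤ) (hm : x * (A 0 0 : ℤ) = x + m)
    (hB : x * (A 0 1 : ℤ) = B) (τ : ℍ) :
    thetaConst x (A • τ : ℍ) * (eta τ ^ 3 * autFactor A τ) =
      eta (A • τ : ℍ) ^ 3 * e ((m + B) / 2 + B * (A 0 0 : ℤ) * x / 2) * thetaConst x τ := by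
  have h := thetaTransforms A (-x * ((A 0 0 : ℤ) * τ + (A 0 1 : ℤ))) τ
  have ne1 := autFactor_ne_zero A τ
  rw [mul_div_assoc, ← coe_smul_eq] at h
  have h1 : oddTheta (-x * ((A 0 0 : ℤ) * τ + (A 0 1 : ℤ))) τ =
      e (m / 2 + B / 2 - m ^ 2 * τ / 2 - m * x * τ) * oddTheta (-x * τ) τ := by
    rw [show -x * ((A 0 0 : ℤ) * (τ : ℂ) + (A 0 1 : ℤ)) =
      (-x * τ + ((-m : ℤ) : ℂ) * τ) + ((-B : ℤ) : ℂ) by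
        push_cast; linear_combination (-τ : ℂ) * hm - hB, oddTheta_add_int, oddTheta_add_int_mul,
        ← mul_assoc, ← e_add, show ((-B : ℤ) : ℂ) / 2 + (((-m : ℤ) : ℂ) / 2 -
          ((-m : ℤ) : ℂ) ^ 2 * τ / 2 - ((-m : ℤ) : ℂ) * (-x * τ)) =
          m / 2 + B / 2 - m ^ 2 * τ / 2 - m * x * τ + ((-B - m : ℤ) : ℂ) by push_cast; ring,
        e_add, e_int, mul_one]
  rw [h1] at h
  have key : e (x ^ 2 / 2 * (A • τ : ℍ)) *
      (e ((A 1 0 : ℤ) * (-x * ((A 0 0 : ℤ) * τ + (A 0 1 : ℤ))) ^ 2 / (2 * autFactor A τ)) *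
      e (m / 2 + B / 2 - m ^ 2 * τ / 2 - m * x * τ)) =
      e ((m + B) / 2 + B * (A 0 0 : ℤ) * x / 2) * e (x ^ 2 / 2 * τ) := by
    rw [← e_add, ← e_add, ← e_add, coe_smul_eq]
    congr 1
    have a3 : ((A 0 0 : ℤ) : ℂ) * (A 1 1 : ℤ) - (A 0 1 : ℤ) * (A 1 0 : ℤ) = 1 := by
      exact_mod_cast det_eq_one A
    have a4 : x ^ 2 * ((A 0 0 : ℤ) * τ + (A 0 1 : ℤ)) *
        (1 + (A 1 0 : ℤ) * ((A 0 0 : ℤ) * τ + (A 0 1 : ℤ))) =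
        autFactor A τ * (x ^ 2 * τ + 2 * x * m * τ + m ^ 2 * τ + x * (A 0 0 : ℤ) * B) := by
      have b1 : 1 + ((A 1 0 : ℤ) : ℂ) * ((A 0 0 : ℤ) * τ + (A 0 1 : ℤ)) =
          (A 0 0 : ℤ) * autFactor A τ := by
        rw [autFactor]; linear_combination -a3
      rw [b1, ← hB]
      linear_combination autFactor A τ * τ * (x * (A 0 0 : ℤ) + x + m) * hm
    field_simp
    linear_combination a4
  rw [thetaConst, thetaConst]
  linear_combination e (x ^ 2 / 2 * (A • τ : ℍ)) * h + eta (A • τ : ℍ) ^ 3 * oddTheta (-x * τ) τ * key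

/-- The triple product at `z = -ρτ` with modulus `Nτ`; the prefactors combine by `N/8 - ρ/2 +
ρ²/(2N) = (N - 2ρ)²/(8N)`. -/
lemma genEta_eq_thetaConst (N : ℕ) (hN : 0 < N) (ρ : ℤ) (τ : ℍ) :
    genEta N ρ τ = thetaConst (ρ / N) (N * (τ : ℂ)) := by
  have hN' : (N : ℂ) ≠ 0 := by exact_mod_cast hN.ne'
  have him : 0 < ((N : ℂ) * (τ : ℂ)).im := by
    simp only [Complex.mul_im, Complex.natCast_re, Complex.natCast_im, zero_mul, add_zero]
    exact mul_pos (by exact_mod_cast hN) τ.2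
  have hq : ∀ x, qPow x τ = e (x * τ) := fun x ↦ by rw [qPow, e]; congr 1; ring
  rw [thetaConst, oddTheta, jacobiTheta₂_eq_aqProd _ him, genEta, hq, hq, hq, hq,
    ← mul_assoc (e (_ / 2 * _)), ← e_add]
  have e1 : -(-((ρ : ℂ) / N) * (N * τ)) = ρ * τ := by field_simp
  have e2 : -((ρ : ℂ) / N) * (N * τ) + N * τ = (N - ρ) * τ := by field_simp; ring
  rw [e1, e2]
  congr 2
  field_simp
  ring

end OddTheta

section Jacobi

open ModularForm (eta)

/-! ### The extended Jacobi symbol -/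

/-- Reciprocity for signed `d`: when `a ≡ 3 (mod 4)`, negating `d` flips both `χ₄(d)` and `(d/a)`,
so the product is unaffected. -/
lemma jacobiSym_natAbs_right {a : ℕ} (ha : Odd a) {d : ℤ} (hd : Odd d) :
    jacobiSym a d.natAbs = (if a % 4 = 1 then 1 else ZMod.χ₄ d) * jacobiSym d a := by
  have key : ∀ n : ℕ, Odd n →
      jacobiSym a n = (if a % 4 = 1 then 1 else ZMod.χ₄ n) * jacobiSym n a := by
    intro n hn
    rw [← jacobiSym.quadratic_reciprocity_if (Nat.odd_iff.mp ha) (Nat.odd_iff.mp hn),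
      ZMod.χ₄_nat_eq_if_mod_four]
    have := Nat.odd_iff.mp ha
    have := Nat.odd_iff.mp hn
    split_ifs <;> omega
  obtain ⟨n, rfl | rfl⟩ := d.eq_nat_or_neg
  · have := key n (by exact_mod_cast hd)
    simpa using this
  · have hn : Odd n := by
      have := hd.neg
      rw [neg_neg] at this
      exact_mod_cast this
    have h1 := key n hn
    rw [Int.natAbs_neg, Int.natAbs_natCast, jacobiSym.neg _ ha, h1, ZMod.χ₄_nat_eq_if_mod_four,
      ZMod.χ₄_nat_eq_if_mod_four, ZMod.χ₄_int_eq_if_mod_four]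
    have := Nat.odd_iff.mp ha
    have := Nat.odd_iff.mp hn
    split_ifs <;> omega

/-- Factors of 2 are stripped off through `χ₈`, and the odd part is periodic by reciprocity. -/
lemma jacobiSym_natAbs_add (a : ℕ) (ha : a ≠ 0) {d m : ℤ} (hd : Odd d) (hm : (4 * a : ℤ) ∣ m) :
    jacobiSym a (d + m).natAbs = jacobiSym a d.natAbs := by
  have hm2 : Even m := even_iff_two_dvd.mpr (dvd_trans ⟨2 * a, by ring⟩ hm)
  have hdm : Odd (d + m) := hd.add_even hm2
  induction a using Nat.strong_induction_on with
  | _ a ih =>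
    rcases Nat.even_or_odd a with he | ho
    · obtain ⟨b, rfl⟩ := he.two_dvd
      have hb : b ≠ 0 := by rintro rfl; simp at ha
      have h1 := ih b (by omega) hb (dvd_trans ⟨2, by push_cast; ring⟩ hm)
      have h2 : ∀ x : ℤ, Odd x → jacobiSym 2 x.natAbs = ZMod.χ₈ x := by
        intro x hx
        rw [jacobiSym.at_two (Int.natAbs_odd.mpr hx), ZMod.χ₈_nat_eq_if_mod_eight,
          ZMod.χ₈_int_eq_if_mod_eight]
        have := Int.odd_iff.mp hx
        split_ifs <;> omega
      have h3 : (8 : ℤ) ∣ m := dvd_trans ⟨b, by push_cast; ring⟩ hm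
      push_cast
      rw [jacobiSym.mul_left, jacobiSym.mul_left, h1, h2 _ hd, h2 _ hdm, Int.cast_add,
        (ZMod.intCast_zmod_eq_zero_iff_dvd m 8).mpr h3, add_zero]
    · have h3 : (4 : ℤ) ∣ m := dvd_trans ⟨a, rfl⟩ hm
      have h4 : (a : ℤ) ∣ m := dvd_trans ⟨4, by ring⟩ hm
      rw [jacobiSym_natAbs_right ho hd, jacobiSym_natAbs_right ho hdm, Int.cast_add,
        (ZMod.intCast_zmod_eq_zero_iff_dvd m 4).mpr h3, add_zero]
      congr 1
      exact jacobiSym.mod_left' (by rw [Int.add_emod, Int.emod_eq_zero_of_dvd h4]; simp)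

lemma extJacobi_of_nonneg {c : ℤ} (hc : 0 ≤ c) (d : ℤ) :
    extJacobi c d = jacobiSym c d.natAbs := by
  rw [extJacobi, if_neg (by omega)]

lemma extJacobi_of_neg {c d : ℤ} (hc : c < 0) (hd : Odd d) :
    extJacobi c d = ZMod.χ₄ d * jacobiSym c.natAbs d.natAbs := by
  have h1 : c = -(c.natAbs : ℤ) := by omega
  have h2 := Int.odd_iff.mp hd
  have h3 := jacobiSym.neg (c.natAbs : ℤ) (Int.natAbs_odd.mpr hd)
  rw [← h1] at h3
  rw [extJacobi, h3, ZMod.χ₄_nat_eq_if_mod_four, ZMod.χ₄_int_eq_if_mod_four]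
  split_ifs <;> omega

lemma extJacobi_add_right {c d : ℤ} (hc : 4 ∣ c) (hd : Odd d) :
    extJacobi c (d + c) = extJacobi c d := by
  rcases eq_or_ne c 0 with rfl | hc0
  · simp
  have hce : Even c := even_iff_two_dvd.mpr (dvd_trans (by norm_num) hc)
  have hdc : Odd (d + c) := hd.add_even hce
  have key : jacobiSym c.natAbs (d + c).natAbs = jacobiSym c.natAbs d.natAbs := by
    -- Removing the square 4 turns the period `4b` into exactly `|c|`.
    obtain ⟨b, hb⟩ : 4 ∣ c.natAbs := by omega
    have hJ : ∀ x : ℤ, Odd x → jacobiSym c.natAbs x.natAbs = jacobiSym b x.natAbs := by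
      intro x hx
      rw [hb, Nat.cast_mul, jacobiSym.mul_left, Nat.cast_ofNat,
        jacobiSym.at_four (Int.natAbs_odd.mpr hx), one_mul]
    rw [hJ _ hd, hJ _ hdc]
    exact jacobiSym_natAbs_add b (by omega) hd (by
      rw [← Int.dvd_natAbs, hb]; push_cast; exact dvd_rfl)
  rcases lt_or_ge c 0 with h | h
  · rw [extJacobi_of_neg h hd, extJacobi_of_neg h hdc, key, Int.cast_add,
      (ZMod.intCast_zmod_eq_zero_iff_dvd c 4).mpr hc, add_zero]
  · rw [extJacobi_of_nonneg h, extJacobi_of_nonneg h]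
    rwa [Int.natAbs_of_nonneg h] at key

/-- The sign changes exactly when `d < 0` and the lower left entry crosses zero;
`etaCubeMult_mul_lowerFour` matches this with the branch of the square root. -/
lemma extJacobi_add_left (c d : ℤ) : extJacobi (c + 4 * d) d =
    if d < 0 ∧ ((c < 0 ∧ 0 ≤ c + 4 * d) ∨ (0 ≤ c ∧ c + 4 * d < 0)) then -extJacobi c d
      else extJacobi c d := by
  have h : jacobiSym (c + 4 * d) d.natAbs = jacobiSym c d.natAbs :=
    jacobiSym.mod_left' (Int.emod_emod_of_dvd _ (dvd_refl _) ▸ by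
      rw [Int.add_emod, Int.emod_eq_zero_of_dvd (Int.natAbs_dvd.mpr (Dvd.intro_left 4 rfl))]; simp)
  rw [extJacobi, extJacobi, h]
  split_ifs <;> omega

/-! ### Branches of the square root -/

lemma cpow_half_mul {x y : ℂ} (hx : x ≠ 0) (hy : y ≠ 0)
    (h : x.arg + y.arg ∈ Set.Ioc (-π) π) :
    (x * y) ^ (1 / 2 : ℂ) = x ^ (1 / 2 : ℂ) * y ^ (1 / 2 : ℂ) := by
  rw [Complex.cpow_def_of_ne_zero (mul_ne_zero hx hy), Complex.cpow_def_of_ne_zero hx,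
    Complex.cpow_def_of_ne_zero hy, (Complex.log_mul_eq_add_log_iff hx hy).mpr h,
    ← Complex.exp_add]
  congr 1; ring

lemma cpow_half_mul_of_pi_lt {x y : ℂ} (hx : x ≠ 0) (hy : y ≠ 0) (h : π < x.arg + y.arg) :
    (x * y) ^ (1 / 2 : ℂ) = -(x ^ (1 / 2 : ℂ) * y ^ (1 / 2 : ℂ)) := by
  have hlog : Complex.log (x * y) = Complex.log x + Complex.log y - 2 * π * Complex.I := by
    have h1 := Complex.arg_le_pi x
    have h2 := Complex.arg_le_pi y
    rw [← Complex.log_exp (x := Complex.log x + Complex.log y - 2 * π * Complex.I)]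
    · rw [Complex.exp_sub, Complex.exp_add, Complex.exp_log hx, Complex.exp_log hy,
        Complex.exp_two_pi_mul_I, div_one]
    · simp [Complex.log_im]; linarith
    · simp [Complex.log_im]; linarith
  rw [Complex.cpow_def_of_ne_zero (mul_ne_zero hx hy), Complex.cpow_def_of_ne_zero hx,
    Complex.cpow_def_of_ne_zero hy, hlog, ← Complex.exp_add,
    show (Complex.log x + Complex.log y - 2 * π * Complex.I) * (1 / 2) =
      Complex.log x * (1 / 2) + Complex.log y * (1 / 2) - π * Complex.I by ring, Complex.exp_sub,
    Complex.exp_pi_mul_I]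
  ring

lemma im_mul_eq_sin (x y : ℂ) : (x * y).im = ‖x‖ * ‖y‖ * Real.sin (x.arg + y.arg) := by
  rw [Real.sin_add, Complex.mul_im]
  have h1 := Complex.norm_mul_cos_arg x
  have h2 := Complex.norm_mul_sin_arg x
  have h3 := Complex.norm_mul_cos_arg y
  have h4 := Complex.norm_mul_sin_arg y
  linear_combination -(‖y‖ * Real.sin y.arg) * h1 - x.re * h4 - (‖y‖ * Real.cos y.arg) * h2 - x.im * h3

lemma arg_mem_Ioo_of_im_pos {x : ℂ} (h : 0 < x.im) : x.arg ∈ Set.Ioo 0 π := by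
  refine ⟨lt_of_le_of_ne (Complex.arg_nonneg_iff.mpr h.le) fun h0 ↦ ?_,
    Complex.arg_lt_pi_iff.mpr (Or.inr h.ne')⟩
  rw [eq_comm, Complex.arg_eq_zero_iff] at h0
  exact h.ne' h0.2

lemma cpow_half_mul_of_im_neg {x y : ℂ} (hx : x.im < 0) (hy : 0 < y.im) :
    (x * y) ^ (1 / 2 : ℂ) = x ^ (1 / 2 : ℂ) * y ^ (1 / 2 : ℂ) := by
  have h1 := Complex.arg_neg_iff.mpr hx
  have h2 := arg_mem_Ioo_of_im_pos hy
  have h3 := Complex.neg_pi_lt_arg x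
  refine cpow_half_mul (by rintro rfl; simp at hx) (by rintro rfl; simp at hy) ⟨?_, ?_⟩ <;>
    linarith [h2.1, h2.2]

/-- The arguments sum to a value in `(0, 2π)`, and the sign of the imaginary part of the product
tells whether `π` has been passed. -/
lemma cpow_half_mul_of_im_pos {x y : ℂ} (hx : 0 < x.im) (hy : 0 < y.im) :
    (x * y) ^ (1 / 2 : ℂ) = if 0 ≤ (x * y).im then x ^ (1 / 2 : ℂ) * y ^ (1 / 2 : ℂ)
      else -(x ^ (1 / 2 : ℂ) * y ^ (1 / 2 : ℂ)) := by
  have h1 := arg_mem_Ioo_of_im_pos hx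
  have h2 := arg_mem_Ioo_of_im_pos hy
  have hx0 : x ≠ 0 := by rintro rfl; simp at hx
  have hy0 : y ≠ 0 := by rintro rfl; simp at hy
  have hp : 0 < ‖x‖ * ‖y‖ := mul_pos (norm_pos_iff.mpr hx0) (norm_pos_iff.mpr hy0)
  rw [im_mul_eq_sin]
  rcases le_or_gt (x.arg + y.arg) π with h | h
  · rw [if_pos, cpow_half_mul hx0 hy0 ⟨by linarith [h1.1, h2.1, Real.pi_pos], h⟩]
    exact mul_nonneg hp.le (Real.sin_nonneg_of_nonneg_of_le_pi (by linarith [h1.1, h2.1]) h)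
  · rw [if_neg, cpow_half_mul_of_pi_lt hx0 hy0 h]
    rw [not_le]
    refine mul_neg_of_pos_of_neg hp ?_
    have := Real.sin_pos_of_pos_of_lt_pi (x := x.arg + y.arg - π) (by linarith)
      (by linarith [h1.2, h2.2])
    rw [Real.sin_sub_pi] at this
    linarith

end Jacobi

section EtaCube

open ModularForm (eta)

/-! ### The multiplier of `η ^ 3` on `Γ₀(4)` -/

/-- The multiplier of `η ^ 3` on `Γ₀(4)`. -/
def etaCubeMult (A : SL(2, ℤ)) : ℂ := ((extJacobi (A 1 0) (A 1 1) : ℤ) : ℂ) *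
  e (((A 1 0 + A 0 1 * A 1 1 + 3 * (A 1 1 - 1) : ℤ) : ℂ) / 8)

/-- The transformation formula for `η ^ 3`. -/
def EtaCubeTransforms (A : SL(2, ℤ)) : Prop := ∀ τ : ℍ, eta (A • τ : ℍ) ^ 3 =
  etaCubeMult A * (autFactor A τ * autFactor A τ ^ (1 / 2 : ℂ)) * eta τ ^ 3

/-- The matrix `(1, 0; 4, 1)`. -/
def lowerFour : SL(2, ℤ) := ⟨!![1, 0; 4, 1], by simp [Matrix.det_fin_two]⟩

lemma odd_of_four_dvd {A : SL(2, ℤ)} (hA : 4 ∣ A 1 0) : Odd (A 0 0) ∧ Odd (A 1 1) := by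
  have h := det_eq_one A
  obtain ⟨k, hk⟩ := hA
  rw [hk] at h
  have h1 : Odd (A 0 0 * A 1 1) := ⟨2 * (A 0 1 * k), by linarith⟩
  exact Int.odd_mul.mp h1

lemma e_int_div_eight_eq {m n : ℤ} (h : (8 : ℤ) ∣ m - n) : e ((m : ℂ) / 8) = e ((n : ℂ) / 8) := by
  obtain ⟨k, hk⟩ := h
  rw [show m = n + 8 * k by linarith,
    show ((n + 8 * k : ℤ) : ℂ) / 8 = n / 8 + k by push_cast; ring, e_add, e_int, mul_one]

lemma mul_apply_fin_two (A B : SL(2, ℤ)) (i j : Fin 2) :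
    (A * B) i j = A i 0 * B 0 j + A i 1 * B 1 j := by
  simp [Matrix.mul_apply, Fin.sum_univ_two]

lemma mul_T_apply (A : SL(2, ℤ)) : (A * ModularGroup.T) 0 0 = A 0 0 ∧
    (A * ModularGroup.T) 0 1 = A 0 0 + A 0 1 ∧ (A * ModularGroup.T) 1 0 = A 1 0 ∧
    (A * ModularGroup.T) 1 1 = A 1 0 + A 1 1 := by
  simp only [mul_apply_fin_two]
  simp [ModularGroup.T]

lemma mul_lowerFour_apply (A : SL(2, ℤ)) : (A * lowerFour) 0 0 = A 0 0 + A 0 1 * 4 ∧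
    (A * lowerFour) 0 1 = A 0 1 ∧ (A * lowerFour) 1 0 = A 1 0 + A 1 1 * 4 ∧
    (A * lowerFour) 1 1 = A 1 1 := by
  simp only [mul_apply_fin_two]
  simp [lowerFour]

/-- Beyond the expected 1, the numerator over 8 grows by `c(a + 3 + 2b)`, divisible by 8 since `4 ∣
c` and `a` is odd. -/
lemma etaCubeMult_mul_T {A : SL(2, ℤ)} (hA : 4 ∣ A 1 0) :
    etaCubeMult (A * ModularGroup.T) = etaCubeMult A * e (1 / 8) := by
  obtain ⟨-, h2, h3, h4⟩ := mul_T_apply A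
  obtain ⟨ha, hd⟩ := odd_of_four_dvd hA
  have hdet := det_eq_one A
  rw [etaCubeMult, etaCubeMult, h2, h3, h4, add_comm (A 1 0) (A 1 1), extJacobi_add_right hA hd,
    mul_assoc, ← e_add, ← add_div]
  congr 1
  have : (((A 1 0 + A 0 1 * A 1 1 + 3 * (A 1 1 - 1) : ℤ) : ℂ) + 1) / 8 =
      ((A 1 0 + A 0 1 * A 1 1 + 3 * (A 1 1 - 1) + 1 : ℤ) : ℂ) / 8 := by push_cast; ring
  rw [this]
  refine e_int_div_eight_eq ?_
  obtain ⟨k, hk⟩ := hA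
  obtain ⟨l, hl⟩ := ha
  refine ⟨A 0 1 * k + k * (l + 2), ?_⟩
  linear_combination hdet + (2 * A 0 1 + A 0 0 + 3) * hk + 4 * k * hl

lemma etaCubeTransforms_mul_T_iff {A : SL(2, ℤ)} (hA : 4 ∣ A 1 0) :
    EtaCubeTransforms (A * ModularGroup.T) ↔ EtaCubeTransforms A := by
  have hj : ∀ τ : ℍ, autFactor (A * ModularGroup.T) τ = autFactor A (ModularGroup.T • τ) := by
    intro τ
    rw [autFactor_mul]
    simp [autFactor, ModularGroup.T]
  have heta : ∀ τ : ℍ, eta (ModularGroup.T • τ : ℍ) ^ 3 = e (1 / 8) * eta τ ^ 3 := by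
    intro τ
    rw [modular_T_smul, coe_vadd, Complex.ofReal_one, add_comm, eta_add_one, mul_pow, ← e_nat_mul]
    congr 2; norm_num
  have key : ∀ τ : ℍ, (eta ((A * ModularGroup.T) • τ : ℍ) ^ 3 = etaCubeMult (A * ModularGroup.T) *
      (autFactor (A * ModularGroup.T) τ * autFactor (A * ModularGroup.T) τ ^ (1 / 2 : ℂ)) *
        eta τ ^ 3) ↔ eta (A • (ModularGroup.T • τ) : ℍ) ^ 3 =
      etaCubeMult A * (autFactor A (ModularGroup.T • τ) *
        autFactor A (ModularGroup.T • τ) ^ (1 / 2 : ℂ)) * eta (ModularGroup.T • τ : ℍ) ^ 3 := by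
    intro τ
    rw [mul_smul, hj, heta, etaCubeMult_mul_T hA]
    ring_nf
  refine ⟨fun h τ ↦ ?_, fun h τ ↦ (key τ).mpr (h _)⟩
  have := (key (ModularGroup.T⁻¹ • τ)).mp (h _)
  rwa [smul_inv_smul] at this

/-- Writing `(1, 0; 4, 1)τ = -1/σ` with `σ = -1/τ - 4` uses two inversions and four translations.
The translations contribute `e(1/6)`, whose cube is -1, and `4τ + 1 = (-iσ)(-iτ)` has both factors
in the right half-plane. -/
lemma eta_lowerFour (τ : ℍ) : eta (lowerFour • τ : ℍ) ^ 3 =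
    -(autFactor lowerFour τ * autFactor lowerFour τ ^ (1 / 2 : ℂ)) * eta τ ^ 3 := by
  have hj : autFactor lowerFour τ = 4 * (τ : ℂ) + 1 := by simp [autFactor, lowerFour]
  have hτ0 : (τ : ℂ) ≠ 0 := τ.ne_zero
  have hj0 := autFactor_ne_zero lowerFour τ
  rw [hj] at hj0 ⊢
  set σ : ℂ := -1 / (τ : ℂ) - 4 with hσ
  have h1 : 0 < (-1 / (τ : ℂ)).im := by
    have := τ.im_inv_neg_coe_pos
    rwa [show -1 / (τ : ℂ) = (-τ : ℂ)⁻¹ by field_simp]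
  have h2 : 0 < σ.im := by simpa [hσ] using h1
  have hσ0 : σ ≠ 0 := by rintro h; simp [h] at h2
  have h3 : ((lowerFour • τ : ℍ) : ℂ) = -1 / σ := by
    have : σ * τ = -(4 * (τ : ℂ) + 1) := by rw [hσ]; field_simp; ring
    rw [coe_smul_eq, hj]
    simp only [lowerFour, Matrix.SpecialLinearGroup.coe_mk, Matrix.cons_val', Matrix.cons_val_zero,
      Matrix.cons_val_one, Matrix.cons_val_fin_one, Int.cast_one, Int.cast_zero, one_mul,
      add_zero, Matrix.of_apply]
    rw [eq_div_iff hσ0, div_mul_eq_mul_div, div_eq_iff hj0]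
    linear_combination this
  have h4 : eta (-1 / (τ : ℂ)) = e (1 / 6) * eta σ := by
    rw [show -1 / (τ : ℂ) = σ + 1 + 1 + 1 + 1 by rw [hσ]; ring, eta_add_one, eta_add_one,
      eta_add_one, eta_add_one, ← mul_assoc, ← mul_assoc, ← mul_assoc, ← e_add, ← e_add, ← e_add]
    congr 2; norm_num
  have h5 : (4 * (τ : ℂ) + 1) ^ (1 / 2 : ℂ) =
      (-Complex.I * σ) ^ (1 / 2 : ℂ) * (-Complex.I * τ) ^ (1 / 2 : ℂ) := by
    have harg : ∀ x : ℂ, 0 < x.im → |(-Complex.I * x).arg| < π / 2 := by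
      intro x hx
      rw [Complex.abs_arg_lt_pi_div_two_iff]
      left; simpa using hx
    have a1 := abs_lt.mp (harg σ h2)
    have a2 := abs_lt.mp (harg τ τ.2)
    rw [← cpow_half_mul (mul_ne_zero (by simp) hσ0) (mul_ne_zero (by simp) hτ0)
      ⟨by linarith, by linarith⟩]
    congr 1
    rw [hσ]
    field_simp
    linear_combination (1 + 4 * (τ : ℂ)) * Complex.I_sq
  have h6 := eta_neg_inv τ.2
  have h7 := eta_neg_inv h2
  have h8 : e (1 / 6) ^ 3 = -1 := by rw [← e_nat_mul, ← e_half]; congr 1; norm_num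
  rw [h4] at h6
  have h9 : eta (lowerFour • τ : ℍ) * e (1 / 6) = (4 * (τ : ℂ) + 1) ^ (1 / 2 : ℂ) * eta τ := by
    rw [h3, h7, h5]; linear_combination (-Complex.I * σ) ^ (1 / 2 : ℂ) * h6
  have h10 := congrArg (· ^ 3) h9
  simp only [mul_pow, h8] at h10
  have h11 := cpow_half_sq (4 * (τ : ℂ) + 1)
  linear_combination -h10 - (4 * (τ : ℂ) + 1) ^ (1 / 2 : ℂ) * eta τ ^ 3 * h11

/-- The exponential gains `e(d/2) = -1` because `d` is odd. The remaining signs cancel: the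
principal root of the product changes branch precisely when the Jacobi symbol flips. -/
lemma etaCubeMult_mul_lowerFour {A : SL(2, ℤ)} (hA : 4 ∣ A 1 0) (τ : ℍ) :
    etaCubeMult (A * lowerFour) *
      (autFactor A (lowerFour • τ) * autFactor lowerFour τ) ^ (1 / 2 : ℂ) =
    -etaCubeMult A * (autFactor A (lowerFour • τ) ^ (1 / 2 : ℂ) *
      autFactor lowerFour τ ^ (1 / 2 : ℂ)) := by
  obtain ⟨-, h2, h3, h4⟩ := mul_lowerFour_apply A
  obtain ⟨ha, hd⟩ := odd_of_four_dvd hA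
  have hdet := det_eq_one A
  have he : e (((A 1 0 + A 1 1 * 4 + A 0 1 * A 1 1 + 3 * (A 1 1 - 1) : ℤ) : ℂ) / 8) =
      -e (((A 1 0 + A 0 1 * A 1 1 + 3 * (A 1 1 - 1) : ℤ) : ℂ) / 8) := by
    rw [← neg_one_mul, ← e_half, ← e_add]
    have : (1 / 2 : ℂ) + ((A 1 0 + A 0 1 * A 1 1 + 3 * (A 1 1 - 1) : ℤ) : ℂ) / 8 =
      ((4 + (A 1 0 + A 0 1 * A 1 1 + 3 * (A 1 1 - 1)) : ℤ) : ℂ) / 8 := by push_cast; ring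
    rw [this]
    refine e_int_div_eight_eq ?_
    obtain ⟨k, hk⟩ := hd
    exact ⟨k, by rw [hk]; ring⟩
  have hs : ((extJacobi (A 1 0 + A 1 1 * 4) (A 1 1) : ℤ) : ℂ) *
      (autFactor A (lowerFour • τ) * autFactor lowerFour τ) ^ (1 / 2 : ℂ) =
      ((extJacobi (A 1 0) (A 1 1) : ℤ) : ℂ) * (autFactor A (lowerFour • τ) ^ (1 / 2 : ℂ) *
      autFactor lowerFour τ ^ (1 / 2 : ℂ)) := by
    have im1 : (autFactor A (lowerFour • τ)).im = A 1 0 * (lowerFour • τ).im := by simp [autFactor]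
    have im2 : 0 < (autFactor lowerFour τ).im := by simpa [autFactor, lowerFour] using τ.im_pos
    have im3 : (autFactor A (lowerFour • τ) * autFactor lowerFour τ).im =
        ((A 1 0 + A 1 1 * 4 : ℤ) : ℝ) * τ.im := by
      rw [← autFactor_mul, autFactor, h3, h4]; simp
    have ne1 := autFactor_ne_zero A (lowerFour • τ)
    have ne2 := autFactor_ne_zero lowerFour τ
    have hd0 : A 1 1 ≠ 0 := by rintro h; simp [h] at hd
    rw [mul_comm (A 1 1) 4, extJacobi_add_left]
    rcases lt_trichotomy (A 1 0) 0 with hc | hc | hc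
    · rw [if_neg (by omega), cpow_half_mul_of_im_neg _ im2]
      rw [im1]
      exact mul_neg_of_neg_of_pos (by exact_mod_cast hc) (lowerFour • τ).im_pos
    · have hjA : autFactor A (lowerFour • τ) = (A 1 1 : ℤ) := by simp [autFactor, hc]
      rw [hc, mul_zero, sub_zero] at hdet
      have ha2 := arg_mem_Ioo_of_im_pos im2
      rcases Int.eq_one_or_neg_one_of_mul_eq_one (by rwa [mul_comm] at hdet) with h | h
      · rw [if_neg (by omega), hjA, h]; simp
      -- Here the automorphy factor of `A` is -1, of argument `π`, so any further positive argument
      -- crosses the cut.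
      · rw [if_pos (by omega), cpow_half_mul_of_pi_lt ne1 ne2]
        · push_cast; ring
        · rw [hjA, h]
          simp only [Int.cast_neg, Int.cast_one, Complex.arg_neg_one]
          linarith [ha2.1]
    · have im4 : 0 < (autFactor A (lowerFour • τ)).im := by
        rw [im1]
        exact mul_pos (by exact_mod_cast hc) (lowerFour • τ).im_pos
      rw [cpow_half_mul_of_im_pos im4 im2, im3]
      rcases le_or_gt 0 (A 1 0 + A 1 1 * 4) with h | h
      · rw [if_neg (by omega), if_pos (mul_nonneg (by exact_mod_cast h) τ.im_pos.le)]
      · rw [if_pos (by omega), if_neg]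
        · push_cast; ring
        · rw [not_le]
          exact mul_neg_of_neg_of_pos (by exact_mod_cast h) τ.im_pos
  rw [etaCubeMult, etaCubeMult, h2, h3, h4, he]
  linear_combination -e (((A 1 0 + A 0 1 * A 1 1 + 3 * (A 1 1 - 1) : ℤ) : ℂ) / 8) * hs

lemma etaCubeTransforms_mul_lowerFour_iff {A : SL(2, ℤ)} (hA : 4 ∣ A 1 0) :
    EtaCubeTransforms (A * lowerFour) ↔ EtaCubeTransforms A := by
  have key : ∀ τ : ℍ, etaCubeMult (A * lowerFour) *
      (autFactor (A * lowerFour) τ * autFactor (A * lowerFour) τ ^ (1 / 2 : ℂ)) *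
        eta τ ^ 3 =
      etaCubeMult A * (autFactor A (lowerFour • τ) *
        autFactor A (lowerFour • τ) ^ (1 / 2 : ℂ)) * eta (lowerFour • τ : ℍ) ^ 3 := by
    intro τ
    rw [autFactor_mul, eta_lowerFour]
    linear_combination autFactor A (lowerFour • τ) * autFactor lowerFour τ * eta τ ^ 3 *
      etaCubeMult_mul_lowerFour hA τ
  refine ⟨fun h τ ↦ ?_, fun h τ ↦ ?_⟩
  · have h1 := h (lowerFour⁻¹ • τ)
    rw [key, mul_smul, smul_inv_smul] at h1
    exact h1
  · rw [key, mul_smul]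
    exact h _

/-! ### Euclidean descent in `Γ₀(4)`. -/

lemma mul_T_zpow_apply (A : SL(2, ℤ)) (n : ℤ) : (A * ModularGroup.T ^ n) 1 0 = A 1 0 ∧
    (A * ModularGroup.T ^ n) 1 1 = n * A 1 0 + A 1 1 := by
  simp only [mul_apply_fin_two, ModularGroup.coe_T_zpow]
  simp [mul_comm]

lemma mul_lowerFour_zpow_apply (A : SL(2, ℤ)) (n : ℤ) :
    (A * lowerFour ^ n) 1 0 = A 1 0 + 4 * n * A 1 1 ∧ (A * lowerFour ^ n) 1 1 = A 1 1 := by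
  induction n using Int.induction_on with
  | zero => simp
  | succ n ih =>
    obtain ⟨-, -, h3, h4⟩ := mul_lowerFour_apply (A * lowerFour ^ (n : ℤ))
    rw [mul_assoc, ← zpow_add_one] at h3 h4
    rw [h3, h4, ih.1, ih.2]
    exact ⟨by ring, rfl⟩
  | pred n ih =>
    obtain ⟨-, -, h3, h4⟩ := mul_lowerFour_apply (A * lowerFour ^ (-(n : ℤ) - 1))
    rw [mul_assoc, ← zpow_add_one, sub_add_cancel] at h3 h4
    rw [ih.1] at h3
    rw [ih.2] at h4
    rw [← h4] at h3 ⊢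
    exact ⟨by linarith, rfl⟩

lemma etaCubeTransforms_mul_T_zpow_iff {A : SL(2, ℤ)} (hA : 4 ∣ A 1 0) (n : ℤ) :
    EtaCubeTransforms (A * ModularGroup.T ^ n) ↔ EtaCubeTransforms A := by
  have h4 : ∀ n : ℤ, 4 ∣ (A * ModularGroup.T ^ n) 1 0 := fun n ↦ by
    rwa [(mul_T_zpow_apply A n).1]
  induction n using Int.induction_on with
  | zero => simp
  | succ n ih => rw [zpow_add_one, ← mul_assoc, etaCubeTransforms_mul_T_iff (h4 _)]; exact ih
  | pred n ih =>
    rw [← etaCubeTransforms_mul_T_iff (h4 _), mul_assoc, ← zpow_add_one, sub_add_cancel]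
    exact ih

lemma etaCubeTransforms_mul_lowerFour_zpow_iff {A : SL(2, ℤ)} (hA : 4 ∣ A 1 0) (n : ℤ) :
    EtaCubeTransforms (A * lowerFour ^ n) ↔ EtaCubeTransforms A := by
  have h4 : ∀ n : ℤ, 4 ∣ (A * lowerFour ^ n) 1 0 := fun n ↦ by
    rw [(mul_lowerFour_zpow_apply A n).1]
    exact dvd_add hA (Dvd.intro _ (mul_assoc _ _ _).symm)
  induction n using Int.induction_on with
  | zero => simp
  | succ n ih => rw [zpow_add_one, ← mul_assoc, etaCubeTransforms_mul_lowerFour_iff (h4 _)]; exact ih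
  | pred n ih =>
    rw [← etaCubeTransforms_mul_lowerFour_iff (h4 _), mul_assoc, ← zpow_add_one, sub_add_cancel]
    exact ih

lemma etaCubeTransforms_one : EtaCubeTransforms 1 := by
  intro τ
  simp [etaCubeMult, autFactor, extJacobi, e]

lemma etaCubeTransforms_neg_one : EtaCubeTransforms (-1) := by
  intro τ
  have h1 : ((-1 : SL(2, ℤ)) 1 1 : ℤ) = -1 := by simp
  have h2 : ((-1 : SL(2, ℤ)) 1 0 : ℤ) = 0 := by simp
  have h3 : ((-1 : SL(2, ℤ)) 0 1 : ℤ) = 0 := by simp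
  have h4 : extJacobi 0 (-1) = 1 := by simp [extJacobi]
  have h5 : (-1 : ℂ) ^ (1 / 2 : ℂ) = e (1 / 4) := by
    rw [Complex.cpow_def_of_ne_zero (by norm_num), Complex.log_neg_one, e]
    congr 1; ring
  have h6 : e ((0 + 0 * -1 + 3 * (-1 - 1) : ℤ) / 8) * (-1 * e (1 / 4)) = 1 := by
    rw [← e_half, ← e_add, ← e_add]
    refine Eq.trans ?_ (e_int 0)
    congr 1; push_cast; norm_num
  have h7 : (((-1 : SL(2, ℤ)) • τ : ℍ) : ℂ) = τ := by simp
  rw [etaCubeMult, autFactor, h1, h2, h3, h4, h7]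
  push_cast at h6 ⊢
  rw [zero_mul, zero_add, h5]
  linear_combination -eta τ ^ 3 * h6

lemma exists_two_mul_abs_add_mul_le (a : ℤ) {b : ℤ} (hb : b ≠ 0) :
    ∃ n : ℤ, 2 * |n * b + a| ≤ |b| := by
  have hp : 0 < |b| := abs_pos.mpr hb
  have h1 := Int.emod_add_mul_ediv a b
  have h2 := Int.emod_nonneg a hb
  have h3 := Int.emod_lt_abs a hb
  rcases le_or_gt (2 * (a % b)) |b| with h | h
  · refine ⟨-(a / b), ?_⟩
    rw [show -(a / b) * b + a = a % b by linear_combination -h1, abs_of_nonneg h2]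
    exact h
  · rcases abs_cases b with ⟨hb1, -⟩ | ⟨hb1, -⟩
    · refine ⟨-(a / b) - 1, ?_⟩
      rw [show (-(a / b) - 1) * b + a = a % b - |b| by linear_combination -h1 + hb1,
        abs_of_neg (by linarith)]
      linarith
    · refine ⟨-(a / b) + 1, ?_⟩
      rw [show (-(a / b) + 1) * b + a = a % b - |b| by linear_combination -h1 + hb1,
        abs_of_neg (by linarith)]
      linarith

/-- The transformation formula for `η ^ 3` holds on `Γ₀(4)`. -/
theorem etaCubeTransforms {A : SL(2, ℤ)} (hA : 4 ∣ A 1 0) : EtaCubeTransforms A := by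
  induction h : (A 1 0).natAbs using Nat.strong_induction_on generalizing A with
  | _ n ih =>
    rcases eq_or_ne (A 1 0) 0 with hc | hc
    -- A vanishing lower left entry forces `A = ±T^n`.
    · have hdet := det_eq_one A
      rw [hc, mul_zero, sub_zero, mul_comm] at hdet
      have hcases : ∃ m : ℤ, A * ModularGroup.T ^ m = 1 ∨ A * ModularGroup.T ^ m = -1 := by
        have hT : ∀ m : ℤ, A * ModularGroup.T ^ m =
            ⟨!![A 0 0, A 0 0 * m + A 0 1; 0, A 1 1], by
              rw [Matrix.det_fin_two_of]; linear_combination hdet⟩ := by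
          intro m
          ext i j
          fin_cases i <;> fin_cases j <;>
            simp [mul_apply_fin_two, ModularGroup.coe_T_zpow, hc]
        rcases Int.eq_one_or_neg_one_of_mul_eq_one hdet with hd | hd
        · have ha : A 0 0 = 1 := by rw [hd] at hdet; linarith
          refine ⟨-A 0 1, Or.inl ?_⟩
          rw [hT]
          ext i j
          fin_cases i <;> fin_cases j <;> simp [ha, hd]
        · have ha : A 0 0 = -1 := by rw [hd] at hdet; linarith
          refine ⟨A 0 1, Or.inr ?_⟩
          rw [hT]
          ext i j
          fin_cases i <;> fin_cases j <;> simp [ha, hd]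
      obtain ⟨m, hm | hm⟩ := hcases
      · rw [← etaCubeTransforms_mul_T_zpow_iff hA m, hm]
        exact etaCubeTransforms_one
      · rw [← etaCubeTransforms_mul_T_zpow_iff hA m, hm]
        exact etaCubeTransforms_neg_one
    -- A power of `T` achieves `2|d| ≤ |c|`, then a power of `lowerFour` achieves `|c'| ≤ 2|d|`. The
    -- descent is strict because `d` is odd and `4 ∣ c`, which excludes `2|d| = |c|`.
    · obtain ⟨k, hk⟩ := exists_two_mul_abs_add_mul_le (A 1 1) hc
      obtain ⟨t1, t2⟩ := mul_T_zpow_apply A k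
      have hA' : 4 ∣ (A * ModularGroup.T ^ k) 1 0 := by rwa [t1]
      have hd' := (odd_of_four_dvd hA').2
      have hd0 : 4 * (A * ModularGroup.T ^ k) 1 1 ≠ 0 := by
        rintro h; have := Int.odd_iff.mp hd'; omega
      obtain ⟨l, hl⟩ := exists_two_mul_abs_add_mul_le (A 1 0) hd0
      obtain ⟨s1, -⟩ := mul_lowerFour_zpow_apply (A * ModularGroup.T ^ k) l
      rw [← etaCubeTransforms_mul_T_zpow_iff hA k, ← etaCubeTransforms_mul_lowerFour_zpow_iff hA' l]
      have hs4 : 4 ∣ (A * ModularGroup.T ^ k * lowerFour ^ l) 1 0 := by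
        rw [s1]; exact dvd_add hA' (Dvd.intro _ (mul_assoc _ _ _).symm)
      refine ih _ ?_ hs4 rfl
      rw [s1, t1, ← h]
      rw [← t2] at hk
      have hd1 := Int.odd_iff.mp hd'
      generalize (A * ModularGroup.T ^ k) 1 1 = d at *
      rw [show A 1 0 + 4 * l * d = l * (4 * d) + A 1 0 by ring]
      generalize l * (4 * d) + A 1 0 = x at *
      generalize A 1 0 = c at *
      rw [Int.abs_eq_natAbs, Int.abs_eq_natAbs] at hk hl
      omega

end EtaCube

section Transformation

open ModularForm (eta)

/-! ### The transformation formula of the eta quotient -/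

/-- Here `98 = 2·7²`: the square contributes 1, and `χ₈` is even, so the sign of `d` does not
matter. -/
lemma extJacobi_ninety_eight_mul (c : ℤ) {d : ℤ} (hd : Odd d) (h7 : IsCoprime 7 d) :
    extJacobi (98 * c) d = ZMod.χ₈ d * extJacobi c d := by
  have h2 : jacobiSym 2 d.natAbs = ZMod.χ₈ d := by
    rw [jacobiSym.at_two (Int.natAbs_odd.mpr hd), ZMod.χ₈_nat_eq_if_mod_eight,
      ZMod.χ₈_int_eq_if_mod_eight]
    have := Int.odd_iff.mp hd
    split_ifs <;> omega
  have h49 : jacobiSym (7 ^ 2) d.natAbs = 1 := by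
    refine jacobiSym.sq_one' ?_
    rw [Int.gcd_comm]
    simpa [Int.gcd_eq_natAbs_gcd_natAbs, Int.natAbs_abs] using Int.isCoprime_iff_gcd_eq_one.mp h7.symm
  have h : jacobiSym (98 * c) d.natAbs = ZMod.χ₈ d * jacobiSym c d.natAbs := by
    rw [show 98 * c = 2 * 7 ^ 2 * c by ring, jacobiSym.mul_left, jacobiSym.mul_left, h2, h49,
      mul_one]
  rw [extJacobi, extJacobi, h]
  split_ifs <;> first | omega | ring

/-- The conjugate of `A` by multiplication with `N`. -/
def conjBy (N : ℤ) (A : SL(2, ℤ)) (hA : N ∣ A 1 0) : SL(2, ℤ) :=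
  ⟨!![A 0 0, N * A 0 1; A 1 0 / N, A 1 1], by
    rw [Matrix.det_fin_two_of, mul_right_comm, mul_comm N, Int.ediv_mul_cancel hA,
      mul_comm (A 1 0), det_eq_one]⟩

/-- The point `N τ` of the upper half-plane. -/
def natMul (N : ℕ) (hN : 0 < N) (τ : ℍ) : ℍ := ⟨N * (τ : ℂ), by
  simpa using mul_pos (by exact_mod_cast hN : (0 : ℝ) < N) τ.im_pos⟩

lemma autFactor_conjBy (N : ℕ) (hN : 0 < N) (A : SL(2, ℤ)) (hA : (N : ℤ) ∣ A 1 0) (τ : ℍ) :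
    autFactor (conjBy N A hA) (natMul N hN τ) = autFactor A τ := by
  have hA' := hA
  obtain ⟨c, hc⟩ := hA'
  have hN' : (N : ℤ) ≠ 0 := by exact_mod_cast hN.ne'
  have : A 1 0 / (N : ℤ) = c := by rw [hc, Int.mul_ediv_cancel_left _ hN']
  have h10 : (conjBy N A hA) 1 0 = c := this
  have h11 : (conjBy N A hA) 1 1 = A 1 1 := rfl
  rw [autFactor, autFactor, h10, h11, hc, show (natMul N hN τ : ℂ) = N * τ from rfl]
  push_cast
  ring

lemma conjBy_smul (N : ℕ) (hN : 0 < N) (A : SL(2, ℤ)) (hA : (N : ℤ) ∣ A 1 0) (τ : ℍ) :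
    ((conjBy N A hA • natMul N hN τ : ℍ) : ℂ) = N * ((A • τ : ℍ) : ℂ) := by
  rw [coe_smul_eq, coe_smul_eq, autFactor_conjBy]
  simp [conjBy, natMul]
  ring

lemma genEta_smul (A : SL(2, ℤ)) {s : ℤ} (hs : A 0 0 = 1 + 28 * s) (hA : ((98 : ℕ) : ℤ) ∣ A 1 0) (k : ℕ)
    (τ : ℍ) : genEta 98 (7 * (k : ℤ)) (A • τ) =
      (eta (98 * ((A • τ : ℍ) : ℂ)) / eta (98 * (τ : ℂ))) ^ 3 / autFactor A τ *
        e (if Even k then 0 else -(A 0 1 : ℤ) / 4) * genEta 98 (7 * (k : ℤ)) τ := by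
  -- The characteristic is `7k/98 = k/14` and the conjugated top row is `(1 + 28s, 98b)`, hence the
  -- shifts `2ks` and `7kb`.
  have hM := thetaConst_smul (conjBy (98 : ℕ) A hA) (((7 * (k : ℤ) : ℤ) : ℂ) / (98 : ℕ)) (2 * k * s)
    (7 * k * A 0 1) (by
      simp only [conjBy, Matrix.SpecialLinearGroup.coe_mk, Matrix.of_apply, Matrix.cons_val', Matrix.cons_val_zero,
        Matrix.cons_val_fin_one, hs]
      push_cast; ring) (by
      simp only [conjBy, Matrix.SpecialLinearGroup.coe_mk, Matrix.of_apply, Matrix.cons_val', Matrix.cons_val_zero,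
        Matrix.cons_val_one, Matrix.cons_val_fin_one]
      push_cast; ring) (natMul 98 (by norm_num) τ)
  rw [autFactor_conjBy, conjBy_smul] at hM
  have h0 : (conjBy (98 : ℕ) A hA) 0 0 = A 0 0 := by simp [conjBy]
  have h1 : ((natMul 98 (by norm_num) τ : ℍ) : ℂ) = (98 : ℕ) * (τ : ℂ) := rfl
  have hne : eta ((98 : ℕ) * (τ : ℂ)) ≠ 0 := by rw [← h1]; exact eta_coe_ne_zero _
  have hj := autFactor_ne_zero A τ
  -- The exponent is `ks + 7kb/2 + k²b(1 + 28s)/4`, which modulo 1 is 0 for even `k` and `-b/4` for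
  -- odd `k`.
  have hu : e ((((2 * k * s : ℤ) : ℂ) + ((7 * k * A 0 1 : ℤ) : ℂ)) / 2 +
      ((7 * k * A 0 1 : ℤ) : ℂ) * ((1 + 28 * s : ℤ) : ℂ) * (((7 * (k : ℤ) : ℤ) : ℂ) / (98 : ℕ)) / 2) =
      e (if Even k then 0 else -(A 0 1 : ℤ) / 4) := by
    split_ifs with hk
    · obtain ⟨l, rfl⟩ := hk.two_dvd
      refine Eq.trans ?_ ((e_int (2 * l * s + 7 * l * A 0 1 + l ^ 2 * A 0 1 * (1 + 28 * s))).trans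
        (e_int 0).symm |>.trans (by simp))
      congr 1; push_cast; ring
    · obtain ⟨l, rfl⟩ := Nat.not_even_iff_odd.mp hk
      refine Eq.trans ?_ ((e_add (((2 * l + 1) * s + A 0 1 * (8 * l + 4 + l ^ 2 + 7 * (2 * l + 1) ^ 2 * s) : ℤ) : ℂ)
        (-(A 0 1 : ℤ) / 4)).trans (by rw [e_int, one_mul]))
      congr 1; push_cast; ring
  rw [h0, hs, hu, h1] at hM
  rw [genEta_eq_thetaConst 98 (by norm_num), genEta_eq_thetaConst 98 (by norm_num)]
  generalize e (if Even k then 0 else -(A 0 1 : ℤ) / 4) = u at hM ⊢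
  push_cast at hM hne ⊢
  field_simp
  linear_combination hM

/-- Conjugation by 98 gives lower left entry `8c` when `γ = 784c`. With `d = 1 + 28t` the
exponential is `e(t/2) e(b/4)`, and `e(t/2) = χ₈(d)` is absorbed in passing from `(8c/d)` to
`(γ/d)`. -/
lemma eta_ninety_eight_cube (A : SL(2, ℤ)) {t : ℤ} (hd : A 1 1 = 1 + 28 * t)
    (hA : 784 ∣ A 1 0) (τ : ℍ) :
    (eta (98 * ((A • τ : ℍ) : ℂ)) / eta (98 * (τ : ℂ))) ^ 3 =
      ((extJacobi (A 1 0) (A 1 1) : ℤ) : ℂ) * e (A 0 1 / 4) *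
        (autFactor A τ * autFactor A τ ^ (1 / 2 : ℂ)) := by
  obtain ⟨c, hc⟩ := hA
  have hA' : ((98 : ℕ) : ℤ) ∣ A 1 0 := ⟨8 * c, by rw [hc]; push_cast; ring⟩
  have h10 : (conjBy (98 : ℕ) A hA') 1 0 = 8 * c := by
    simp [conjBy, hc]; omega
  have h11 : (conjBy (98 : ℕ) A hA') 1 1 = A 1 1 := by simp [conjBy]
  have h01 : (conjBy (98 : ℕ) A hA') 0 1 = 98 * A 0 1 := by simp [conjBy]
  have h := etaCubeTransforms (A := conjBy (98 : ℕ) A hA') (by rw [h10]; omega)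
    (natMul 98 (by norm_num) τ)
  have h1 : ((natMul 98 (by norm_num) τ : ℍ) : ℂ) = (98 : ℕ) * (τ : ℂ) := rfl
  have hne : eta ((98 : ℕ) * (τ : ℂ)) ≠ 0 := by rw [← h1]; exact eta_coe_ne_zero _
  rw [autFactor_conjBy, conjBy_smul, h1] at h
  have hm : etaCubeMult (conjBy (98 : ℕ) A hA') =
      ((extJacobi (A 1 0) (A 1 1) : ℤ) : ℂ) * e (A 0 1 / 4) := by
    have hodd : Odd (A 1 1) := ⟨14 * t, by rw [hd]; ring⟩
    have h8 : ((ZMod.χ₈ (A 1 1) : ℤ) : ℂ) = e (t / 2) := by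
      have he : e (t / 2) = (-1) ^ t := by
        rw [← e_half, ← e_int_mul]; congr 1; ring
      rw [he, ZMod.χ₈_int_eq_if_mod_eight]
      rcases Int.even_or_odd t with h | h
      · rw [h.neg_one_zpow, if_neg, if_pos]
        · simp
        · obtain ⟨l, rfl⟩ := h.two_dvd; omega
        · omega
      · rw [h.neg_one_zpow, if_neg, if_neg]
        · simp
        · obtain ⟨l, rfl⟩ := h; omega
        · omega
    have hE : e (((8 * c + 98 * A 0 1 * A 1 1 + 3 * (A 1 1 - 1) : ℤ) : ℂ) / 8) =
        e (t / 2) * e (A 0 1 / 4) := by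
      rw [← e_add, hd]
      refine Eq.trans ?_ ((e_add ((c + 12 * A 0 1 + 343 * A 0 1 * t + 10 * t : ℤ) : ℂ)
        (t / 2 + A 0 1 / 4)).trans (by rw [e_int, one_mul]))
      congr 1; push_cast; ring
    rw [etaCubeMult, h10, h11, h01, show A 1 0 = 98 * (8 * c) by rw [hc]; ring,
      extJacobi_ninety_eight_mul _ hodd ⟨-4 * t, 1, by rw [hd]; ring⟩, Int.cast_mul, h8, hE]
    ring
  rw [hm] at h
  push_cast at h hne
  rw [div_pow, h, mul_div_assoc, div_self (pow_ne_zero 3 hne), mul_one]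

lemma extJacobi_sq {c d : ℤ} (h : IsCoprime c d) : extJacobi c d ^ 2 = 1 := by
  have h1 : jacobiSym c d.natAbs ^ 2 = 1 := by
    refine jacobiSym.sq_one ?_
    simpa [Int.gcd_eq_natAbs_gcd_natAbs, Int.natAbs_abs] using Int.isCoprime_iff_gcd_eq_one.mp h
  rw [extJacobi]
  split_ifs
  · rw [neg_sq, h1]
  · exact h1

lemma prod_Icc_one_seven {M : Type*} [CommMonoid M] (f : ℕ → M) :
    ∏ k ∈ Finset.Icc (1 : ℕ) 7, f k = f 1 * f 2 * f 3 * f 4 * f 5 * f 6 * f 7 := by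
  simp [Finset.prod_Icc_succ_top]

theorem etaQuot_smul (r : ℕ → ℤ) (R S : ℤ)
    (hR : R = r 1 + r 2 + r 3 + r 4 + r 5 + r 6 + r 7)
    (hS : S = r 1 + r 3 + r 5 + r 7)
    (h₁ : r 0 + R = 1)
    (h₂ : r 0 + 3 * R ≡ -3 [ZMOD 24])
    (h₃ : 1 + S ≡ 0 [ZMOD 4]) {A : SL(2, ℤ)} (hA : A ∈ Gamma1 28 ⊓ Gamma0 784) (τ : ℍ) :
    etaQuot r (A • τ) =
      ((extJacobi (A 1 0) (A 1 1) : ℤ) : ℂ) * autFactor A τ ^ (1 / 2 : ℂ) * etaQuot r τ := by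
  obtain ⟨hA1, hA0⟩ := Subgroup.mem_inf.mp hA
  rw [Gamma1_mem] at hA1
  rw [Gamma0_mem, ZMod.intCast_zmod_eq_zero_iff_dvd] at hA0
  obtain ⟨ha, hd, -⟩ := hA1
  have hs : ∃ s, A 0 0 = 1 + 28 * s := by
    obtain ⟨s, hs⟩ := (ZMod.intCast_eq_intCast_iff_dvd_sub 1 (A 0 0) 28).mp (by simpa using ha.symm)
    exact ⟨s, by push_cast at hs; linarith⟩
  have ht : ∃ t, A 1 1 = 1 + 28 * t := by
    obtain ⟨s, hs⟩ := (ZMod.intCast_eq_intCast_iff_dvd_sub 1 (A 1 1) 28).mp (by simpa using hd.symm)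
    exact ⟨s, by push_cast at hs; linarith⟩
  obtain ⟨s, hs⟩ := hs
  obtain ⟨t, ht⟩ := ht
  push_cast at hA0
  have hA98 : ((98 : ℕ) : ℤ) ∣ A 1 0 := dvd_trans ⟨8, by norm_num⟩ hA0
  have hL3 := eta_ninety_eight_cube A ht hA0 τ
  have hg := genEta_smul A hs hA98
  have hcop : IsCoprime (A 1 0) (A 1 1) := ⟨-A 0 1, A 0 0, by linarith [det_eq_one A]⟩
  have hx2 : ((extJacobi (A 1 0) (A 1 1) : ℤ) : ℂ) ^ 2 = 1 := by exact_mod_cast extJacobi_sq hcop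
  have hne : ∀ σ : ℍ, eta (98 * (σ : ℂ)) ≠ 0 := fun σ ↦ by
    simpa [natMul] using eta_coe_ne_zero (natMul 98 (by norm_num) σ)
  have hj := autFactor_ne_zero A τ
  have hL0 : eta (98 * ((A • τ : ℍ) : ℂ)) / eta (98 * (τ : ℂ)) ≠ 0 := div_ne_zero (hne _) (hne _)
  have hL : eta (98 * ((A • τ : ℍ) : ℂ)) =
      eta (98 * ((A • τ : ℍ) : ℂ)) / eta (98 * (τ : ℂ)) * eta (98 * (τ : ℂ)) :=
    (div_mul_cancel₀ _ (hne τ)).symm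
  rw [etaQuot, etaQuot, prod_Icc_one_seven, prod_Icc_one_seven]
  simp only [hg]
  generalize eta (98 * ((A • τ : ℍ) : ℂ)) / eta (98 * (τ : ℂ)) = L at *
  rw [hL]
  generalize eta (98 * (τ : ℂ)) = E
  have hq := cpow_half_sq (autFactor A τ)
  have hsq0 : autFactor A τ ^ (1 / 2 : ℂ) ≠ 0 := fun h ↦ hj (by rw [← hq, h]; ring)
  generalize autFactor A τ ^ (1 / 2 : ℂ) = w at *
  generalize ((extJacobi (A 1 0) (A 1 1) : ℤ) : ℂ) = x at *
  generalize autFactor A τ = j at *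
  have e0 : e 0 = 1 := by simp [e]
  have n2 : ¬ Even 1 := by decide
  have n3 : ¬ Even 3 := by decide
  have n5 : ¬ Even 5 := by decide
  have n7 : ¬ Even 7 := by decide
  have m2 : Even 2 := by decide
  have m4 : Even 4 := by decide
  have m6 : Even 6 := by decide
  simp only [n2, n3, n5, n7, m2, m4, m6, if_true, if_false, e0, mul_one]
  obtain ⟨n, hn⟩ := h₂.symm.dvd
  obtain ⟨m, hm⟩ := h₃.symm.dvd
  set u := e (-(A 0 1 : ℤ) / 4) with hu
  have hu0 : u ≠ 0 := e_ne_zero _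
  have huu : e ((A 0 1 : ℤ) / 4) = u⁻¹ := by rw [hu, ← e_neg]; congr 1; ring
  have hu4 : u ^ 4 = 1 := by
    rw [hu, ← e_nat_mul, ← e_int (-A 0 1)]; congr 1; push_cast; ring
  rw [huu] at hL3
  have hx0 : x ≠ 0 := by rintro rfl; simp at hx2
  -- Write `r₀ + 3R = 24n - 3`, so `R = 12n - 2`. From `x² = u⁴ = 1` and `w² = j` follows `(L³)⁸ =
  -- j¹²`; with `u^S = u⁻¹` the factor becomes `x⁻¹ j / w = x w`.
  have key : L ^ r 0 * (L ^ 3 / j) ^ R * u ^ S = x * w := by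
    have r1 : L ^ r 0 * (L ^ 3) ^ R = (L ^ 3) ^ (8 * n - 1) := by
      have a1 : (L ^ 3) ^ R = L ^ (3 * R) := by rw [zpow_mul]; norm_cast
      have a2 : (L ^ 3) ^ (8 * n - 1) = L ^ (3 * (8 * n - 1)) := by rw [zpow_mul]; norm_cast
      rw [a1, a2, ← zpow_add₀ hL0]
      congr 1
      linarith
    have r2 : (L ^ 3) ^ (8 * n) = j ^ (12 * n) := by
      rw [zpow_mul, zpow_mul, hL3]
      congr 1
      have : (x * u⁻¹ * (j * w)) ^ 8 = (x ^ 2) ^ 4 * ((u ^ 4)⁻¹) ^ 2 * j ^ 8 * (w ^ 2) ^ 4 := by ring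
      norm_cast
      rw [this, hx2, hu4, hq]
      ring
    have r3 : R = 12 * n - 2 := by linarith
    have r4 : u ^ S = u⁻¹ := by
      rw [show S = 4 * m + -1 by linarith, zpow_add₀ hu0, zpow_mul]
      norm_cast
      rw [hu4]
      simp
    have r5 : j ^ R = j ^ (12 * n) * (j ^ 2)⁻¹ := by
      rw [r3, zpow_sub₀ hj]; norm_cast
    have r6 : j ^ (12 * n) ≠ 0 := zpow_ne_zero _ hj
    rw [div_zpow, ← mul_div_assoc, r1, zpow_sub₀ (pow_ne_zero 3 hL0), r2, r4, r5, zpow_one, hL3]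
    field_simp
    rw [hx2, hq]
    ring
  rw [← key, hR, hS]
  have hj3 : L ^ 3 / j ≠ 0 := div_ne_zero (pow_ne_zero _ hL0) hj
  generalize L ^ 3 / j = X at hj3
  simp only [mul_zpow, zpow_add₀ hj3, zpow_add₀ hu0]
  ring

end Transformation

section Growth

open ModularForm (eta)
open Filter Topology

/-! ### Growth of eta quotients -/

/-- `‖∏ (1 - x ^ (n + 1))‖` for real `x`. -/
def eulerNorm (x : ℝ) : ℝ := ‖∏' n : ℕ, (1 - (x : ℂ) ^ (n + 1))‖

lemma tendsto_eulerNorm {x : ℝ} (h0 : 0 ≤ x) (h1 : x < 1) :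
    Tendsto (fun n ↦ ∏ i ∈ Finset.range n, (1 - x ^ (i + 1))) atTop (𝓝 (eulerNorm x)) := by
  have hx : ‖(x : ℂ)‖ < 1 := by rwa [Complex.norm_real, Real.norm_of_nonneg h0]
  refine (tendsto_qFactorial hx).norm.congr fun n ↦ ?_
  rw [qFactorial, norm_prod]
  refine Finset.prod_congr rfl fun i _ ↦ ?_
  have h := pow_le_one₀ (n := i + 1) h0 h1.le
  have : (1 - (x : ℂ) ^ (i + 1)) = ((1 - x ^ (i + 1) : ℝ) : ℂ) := by push_cast; rfl
  rw [this, Complex.norm_real, Real.norm_of_nonneg (by linarith)]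

lemma eulerNorm_pos {x : ℝ} (h0 : 0 ≤ x) (h1 : x < 1) : 0 < eulerNorm x := by
  have hx : ‖(x : ℂ)‖ < 1 := by rwa [Complex.norm_real, Real.norm_of_nonneg h0]
  exact norm_pos_iff.mpr (tprod_one_sub_pow_ne_zero hx)

lemma multipliable_one_sub_of_norm_le {x : ℝ} (h0 : 0 ≤ x) (h1 : x < 1) {u : ℕ → ℂ}
    (hu : ∀ n, ‖u n‖ ≤ x ^ (n + 1)) : Multipliable fun n ↦ 1 - u n := by
  simp only [sub_eq_add_neg]
  refine multipliable_one_add_of_summable (f := fun n ↦ -u n) ?_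
  simp only [norm_neg]
  exact Summable.of_nonneg_of_le (fun _ ↦ norm_nonneg _) hu
    ((summable_nat_add_iff 1).mpr (summable_geometric_of_lt_one h0 h1))

lemma eulerNorm_le_norm_tprod {x : ℝ} (h0 : 0 ≤ x) (h1 : x < 1) {u : ℕ → ℂ}
    (hu : ∀ n, ‖u n‖ ≤ x ^ (n + 1)) : eulerNorm x ≤ ‖∏' n, (1 - u n)‖ := by
  refine le_of_tendsto_of_tendsto' (tendsto_eulerNorm h0 h1)
    (multipliable_one_sub_of_norm_le h0 h1 hu).hasProd.tendsto_prod_nat.norm fun n ↦ ?_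
  rw [norm_prod]
  refine Finset.prod_le_prod (fun i _ ↦ ?_) fun i _ ↦ ?_
  · have h := pow_le_one₀ (n := i + 1) h0 h1.le
    linarith
  · have h2 := norm_sub_norm_le (1 : ℂ) (u i)
    rw [norm_one] at h2
    linarith [hu i]

/-- Factor by factor, `1 + t ≤ 1/(1 - t)` for `0 ≤ t < 1`. -/
lemma norm_tprod_le_inv_eulerNorm {x : ℝ} (h0 : 0 ≤ x) (h1 : x < 1) {u : ℕ → ℂ}
    (hu : ∀ n, ‖u n‖ ≤ x ^ (n + 1)) : ‖∏' n, (1 - u n)‖ ≤ (eulerNorm x)⁻¹ := by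
  refine le_of_tendsto_of_tendsto'
    (multipliable_one_sub_of_norm_le h0 h1 hu).hasProd.tendsto_prod_nat.norm
    ((tendsto_eulerNorm h0 h1).inv₀ (eulerNorm_pos h0 h1).ne') fun n ↦ ?_
  rw [norm_prod, ← Finset.prod_inv_distrib]
  refine Finset.prod_le_prod (fun i _ ↦ norm_nonneg _) fun i _ ↦ ?_
  have h : x ^ (i + 1) < 1 := pow_lt_one₀ h0 h1 (by omega)
  have h2 := norm_sub_le (1 : ℂ) (u i)
  rw [norm_one] at h2
  have h3 : 0 ≤ x ^ (i + 1) := pow_nonneg h0 _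
  rw [← one_div, le_div_iff₀ (by linarith)]
  have h4 : ‖1 - u i‖ ≤ 1 + x ^ (i + 1) := h2.trans (by linarith [hu i])
  nlinarith [mul_le_mul_of_nonneg_right h4 (by linarith : 0 ≤ 1 - x ^ (i + 1))]

lemma norm_eta_I_mul (y : ℝ) : ‖eta (Complex.I * y)‖ =
    Real.exp (-(π / 12) * y) * eulerNorm (Real.exp (-2 * π * y)) := by
  have h1 : Function.Periodic.qParam 1 (Complex.I * y) = (Real.exp (-2 * π * y) : ℂ) := by
    rw [Function.Periodic.qParam, Complex.ofReal_exp]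
    congr 1
    push_cast
    linear_combination (2 * π * y : ℂ) * Complex.I_sq
  rw [eta, norm_mul, Function.Periodic.norm_qParam, eulerNorm]
  simp only [ModularForm.eta_q, h1]
  congr 2
  simp
  ring

/-- For `y ≥ 1` the Euler product is at least its value at `y = 1`. For `y ≤ 1`, the relation
`η(i/y) = √y η(iy)` transfers that bound at the cost of `exp(-π/(12y))`. -/
lemma exists_le_eulerNorm : ∃ c : ℝ, 0 < c ∧ ∀ y : ℝ, 0 < y →
    c * Real.exp (-(π / 12) / y) ≤ eulerNorm (Real.exp (-2 * π * y)) := by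
  have hlt : ∀ y : ℝ, 0 < y → Real.exp (-2 * π * y) < 1 := fun y hy ↦ by
    rw [Real.exp_lt_one_iff]; nlinarith [mul_pos Real.pi_pos hy]
  set c := eulerNorm (Real.exp (-2 * π * 1)) with hc
  have hmono : ∀ y : ℝ, 1 ≤ y → c ≤ eulerNorm (Real.exp (-2 * π * y)) := by
    intro y hy
    refine eulerNorm_le_norm_tprod (Real.exp_pos _).le (hlt 1 one_pos) fun n ↦ ?_
    rw [norm_pow, Complex.norm_real, Real.norm_of_nonneg (Real.exp_pos _).le]
    refine pow_le_pow_left₀ (Real.exp_pos _).le (Real.exp_le_exp.mpr ?_) _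
    nlinarith [Real.pi_pos]
  have hc0 : 0 < c := eulerNorm_pos (Real.exp_pos _).le (hlt 1 one_pos)
  refine ⟨c, hc0, fun y hy ↦ ?_⟩
  rcases le_total 1 y with h | h
  · refine le_trans (mul_le_of_le_one_right hc0.le ?_) (hmono y h)
    rw [Real.exp_le_one_iff, neg_div]
    have : 0 < π / 12 / y := by positivity
    linarith
  · have h1 := eta_neg_inv (τ := Complex.I * y) (by simpa using hy)
    have h2 : -1 / (Complex.I * y) = Complex.I * ((y⁻¹ : ℝ) : ℂ) := by
      have : (y : ℂ) ≠ 0 := by exact_mod_cast hy.ne'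
      push_cast
      field_simp
      simp
    have h3 : -Complex.I * (Complex.I * y) = y := by linear_combination -(y : ℂ) * Complex.I_sq
    rw [h2, h3] at h1
    have h4 := congrArg norm h1
    rw [norm_mul, norm_eta_I_mul y⁻¹, norm_eta_I_mul y,
      Complex.norm_cpow_eq_rpow_re_of_pos hy] at h4
    have h5 : y ^ (1 / 2 : ℂ).re ≤ 1 := Real.rpow_le_one hy.le h (by norm_num)
    have h6 : Real.exp (-(π / 12) * y) ≤ 1 := by
      rw [Real.exp_le_one_iff]
      have := mul_pos Real.pi_pos hy
      linarith
    have h7 := eulerNorm_pos (Real.exp_pos (-2 * π * y)).le (hlt y hy)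
    have h8 := hmono y⁻¹ ((one_le_inv₀ hy).mpr h)
    calc c * Real.exp (-(π / 12) / y)
        ≤ eulerNorm (Real.exp (-2 * π * y⁻¹)) * Real.exp (-(π / 12) / y) := by gcongr
      _ = y ^ (1 / 2 : ℂ).re * (Real.exp (-(π / 12) * y) * eulerNorm (Real.exp (-2 * π * y))) := by
        rw [← h4, div_eq_mul_inv, mul_comm]
      _ ≤ 1 * (1 * eulerNorm (Real.exp (-2 * π * y))) := by gcongr
      _ = _ := by ring

/-- Functions without zeros whose size and inverse are at most exponential in `y + 1 / y`. -/
def ControlledGrowth (f : ℍ → ℂ) : Prop :=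
  ∃ C : ℝ, ∀ τ : ℍ, f τ ≠ 0 ∧ |Real.log ‖f τ‖| ≤ C * (τ.im + 1 / τ.im)

lemma ControlledGrowth.mul {f g : ℍ → ℂ} (hf : ControlledGrowth f) (hg : ControlledGrowth g) :
    ControlledGrowth fun τ ↦ f τ * g τ := by
  obtain ⟨C, hC⟩ := hf
  obtain ⟨D, hD⟩ := hg
  refine ⟨C + D, fun τ ↦ ⟨mul_ne_zero (hC τ).1 (hD τ).1, ?_⟩⟩
  rw [norm_mul, Real.log_mul (norm_ne_zero_iff.mpr (hC τ).1) (norm_ne_zero_iff.mpr (hD τ).1),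
    add_mul]
  exact (abs_add_le _ _).trans (add_le_add (hC τ).2 (hD τ).2)

lemma ControlledGrowth.zpow {f : ℍ → ℂ} (hf : ControlledGrowth f) (n : ℤ) :
    ControlledGrowth fun τ ↦ f τ ^ n := by
  obtain ⟨C, hC⟩ := hf
  refine ⟨|(n : ℝ)| * C, fun τ ↦ ⟨zpow_ne_zero _ (hC τ).1, ?_⟩⟩
  rw [norm_zpow, Real.log_zpow, abs_mul, mul_assoc]
  exact mul_le_mul_of_nonneg_left (hC τ).2 (abs_nonneg _)

lemma controlledGrowth_prod {ι : Type*} (s : Finset ι) {f : ι → ℍ → ℂ}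
    (hf : ∀ i ∈ s, ControlledGrowth (f i)) : ControlledGrowth fun τ ↦ ∏ i ∈ s, f i τ := by
  classical
  induction s using Finset.induction_on with
  | empty => exact ⟨0, fun τ ↦ by simp⟩
  | insert a s ha ih =>
    simp only [Finset.prod_insert ha]
    exact (hf a (Finset.mem_insert_self a s)).mul
      (ih fun i hi ↦ hf i (Finset.mem_insert_of_mem hi))

lemma norm_qPow (x : ℝ) (τ : ℍ) : ‖qPow x τ‖ = Real.exp (-2 * π * x * τ.im) := by
  rw [qPow, Complex.norm_exp]
  congr 1
  simp [mul_assoc]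

lemma controlledGrowth_qPow (x : ℝ) : ControlledGrowth (qPow x) := by
  refine ⟨2 * π * |x|, fun τ ↦ ⟨Complex.exp_ne_zero _, ?_⟩⟩
  have h := τ.im_pos
  have h1 : 0 < 1 / τ.im := by positivity
  rw [norm_qPow, Real.log_exp, abs_mul, abs_mul, abs_of_pos h, abs_mul, abs_neg, abs_two,
    abs_of_pos Real.pi_pos]
  gcongr
  linarith

lemma controlledGrowth_tprod {u : ℍ → ℕ → ℂ}
    (hu : ∀ τ n, ‖u τ n‖ ≤ Real.exp (-2 * π * τ.im) ^ (n + 1)) :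
    ControlledGrowth fun τ ↦ ∏' n, (1 - u τ n) := by
  obtain ⟨c, hc, hE⟩ := exists_le_eulerNorm
  refine ⟨|Real.log c| + 1, fun τ ↦ ?_⟩
  have hy := τ.im_pos
  have h0 := (Real.exp_pos (-2 * π * τ.im)).le
  have h1 : Real.exp (-2 * π * τ.im) < 1 := by
    rw [Real.exp_lt_one_iff]; nlinarith [mul_pos Real.pi_pos hy]
  have a1 := eulerNorm_le_norm_tprod h0 h1 (hu τ)
  have a2 := norm_tprod_le_inv_eulerNorm h0 h1 (hu τ)
  have a3 := eulerNorm_pos h0 h1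
  refine ⟨norm_pos_iff.mp (a3.trans_le a1), ?_⟩
  have b1 := Real.log_le_log a3 a1
  have b2 := Real.log_le_log (a3.trans_le a1) a2
  have b3 := Real.log_le_log (mul_pos hc (Real.exp_pos _)) (hE τ.im hy)
  rw [Real.log_inv] at b2
  rw [Real.log_mul hc.ne' (Real.exp_pos _).ne', Real.log_exp] at b3
  have c1 : |Real.log ‖∏' n, (1 - u τ n)‖| ≤ |Real.log c| + π / 12 / τ.im := by
    rw [neg_div] at b3
    have := neg_abs_le (Real.log c)
    rw [abs_le]
    constructor <;> linarith
  refine c1.trans ?_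
  -- This absorbs the additive constant `|log c|` into the linear bound.
  have d1 : 1 ≤ τ.im + 1 / τ.im := by
    rcases le_total 1 τ.im with h | h
    · have : 0 < 1 / τ.im := by positivity
      linarith
    · have : 1 ≤ 1 / τ.im := (one_le_div₀ hy).mpr h
      linarith
  have d2 : π / 12 / τ.im ≤ 1 / τ.im := by
    gcongr
    linarith [Real.pi_lt_four]
  have d3 : |Real.log c| * 1 ≤ |Real.log c| * (τ.im + 1 / τ.im) :=
    mul_le_mul_of_nonneg_left d1 (abs_nonneg _)
  linarith

lemma controlledGrowth_aqProd {m N : ℕ} (hm : 1 ≤ m) (hN : 1 ≤ N) :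
    ControlledGrowth fun τ ↦ aqProd (qPow m τ) (qPow N τ) := by
  refine controlledGrowth_tprod fun τ n ↦ ?_
  have h1 := norm_qPow m τ
  have h2 := norm_qPow N τ
  push_cast at h1 h2
  rw [norm_mul, norm_pow, h1, h2, ← Real.exp_nat_mul, ← Real.exp_nat_mul, ← Real.exp_add,
    Real.exp_le_exp]
  have hm' : (1 : ℝ) ≤ m := by exact_mod_cast hm
  have hN' : (1 : ℝ) ≤ N := by exact_mod_cast hN
  have hn : (0 : ℝ) ≤ n := n.cast_nonneg
  have h3 : (n : ℝ) + 1 ≤ m + n * N := by nlinarith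
  have h4 := mul_le_mul_of_nonneg_left h3 (mul_pos Real.pi_pos τ.im_pos).le
  push_cast
  linarith

lemma controlledGrowth_genEta {N ρ : ℕ} (hρ : 1 ≤ ρ) (hN : ρ < N) :
    ControlledGrowth (genEta N ρ) := by
  have h1 := controlledGrowth_qPow (((N : ℝ) - 2 * ρ) ^ 2 / (8 * N))
  have h2 := controlledGrowth_aqProd hρ (by omega : 1 ≤ N)
  have h3 := controlledGrowth_aqProd (by omega : 1 ≤ N - ρ) (by omega : 1 ≤ N)
  have h4 := controlledGrowth_aqProd (by omega : 1 ≤ N) (by omega : 1 ≤ N)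
  have := h1.mul ((h2.mul h3).mul h4)
  rw [Nat.cast_sub hN.le] at this
  convert this using 2 with τ
  rw [genEta]
  push_cast
  rfl

lemma controlledGrowth_eta {N : ℕ} (hN : 1 ≤ N) :
    ControlledGrowth fun τ ↦ eta (N * (τ : ℂ)) := by
  convert (controlledGrowth_qPow (N / 24)).mul (controlledGrowth_aqProd hN hN) using 2 with τ
  rw [eta, aqProd, qPow, Function.Periodic.qParam]
  congr 1
  · congr 1; push_cast; ring
  · congr 1; ext n
    rw [ModularForm.eta_q, Function.Periodic.qParam, ← pow_succ', qPow]
    congr 3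
    push_cast; ring

lemma controlledGrowth_etaQuot (r : ℕ → ℤ) : ControlledGrowth (etaQuot r) := by
  have h1 := (controlledGrowth_eta (N := 98) (by norm_num)).zpow (r 0)
  have h2 := controlledGrowth_prod (Finset.Icc (1 : ℕ) 7) (f := fun k τ ↦ genEta 98 (7 * k) τ ^ r k)
    fun k hk ↦ by
      rw [Finset.mem_Icc] at hk
      have := (controlledGrowth_genEta (N := 98) (ρ := 7 * k) (by omega) (by omega)).zpow (r k)
      push_cast at this
      exact this
  exact_mod_cast h1.mul h2

end Growth

section Cusps

open ModularForm (eta)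

/-! ### Holomorphy and expansions at the cusps -/

lemma differentiableAt_thetaConst (x : ℂ) {z : ℂ} (hz : 0 < z.im) :
    DifferentiableAt ℂ (thetaConst x) z := by
  have h1 : DifferentiableAt ℂ (fun z : ℂ ↦ jacobiTheta₂ (-x * z + z / 2 + 1 / 2) z) z := by
    have h := (hasFDerivAt_jacobiTheta₂ (-x * z + z / 2 + 1 / 2) hz).differentiableAt
    exact h.comp (f := fun z : ℂ ↦ (-x * z + z / 2 + 1 / 2, z)) z (by fun_prop)
  unfold thetaConst oddTheta e
  fun_prop

/-- The eta quotient as a function of a complex variable. -/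
def etaQuotC (r : ℕ → ℤ) (z : ℂ) : ℂ := eta (98 * z) ^ r 0 *
  ∏ k ∈ Finset.Icc (1 : ℕ) 7, thetaConst (((7 * (k : ℤ) : ℤ) : ℂ) / (98 : ℕ)) (98 * z) ^ r k

lemma etaQuot_eq_etaQuotC (r : ℕ → ℤ) (τ : ℍ) : etaQuot r τ = etaQuotC r τ := by
  rw [etaQuot, etaQuotC]
  congr 1
  refine Finset.prod_congr rfl fun k _ ↦ ?_
  rw [genEta_eq_thetaConst 98 (by norm_num)]
  norm_cast

/-- Negative exponents require zero-free factors; for the theta constants this comes from the growth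
estimate. -/
lemma differentiableAt_etaQuotC (r : ℕ → ℤ) {z : ℂ} (hz : 0 < z.im) :
    DifferentiableAt ℂ (etaQuotC r) z := by
  have h98 : 0 < (98 * z).im := by simpa using hz
  refine DifferentiableAt.mul ?_ ?_
  · refine DifferentiableAt.zpow ?_ (Or.inl (ModularForm.eta_ne_zero h98))
    exact (ModularForm.differentiableAt_eta_of_mem_upperHalfPlaneSet h98).comp z (by fun_prop)
  · refine DifferentiableAt.fun_finsetProd fun k hk ↦ ?_
    refine DifferentiableAt.zpow ?_ (Or.inl ?_)
    · exact (differentiableAt_thetaConst _ h98).comp z (by fun_prop)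
    · rw [Finset.mem_Icc] at hk
      obtain ⟨C, hC⟩ := controlledGrowth_genEta (N := 98) (ρ := 7 * k) (by omega) (by omega)
      have := (hC ⟨z, hz⟩).1
      rw [genEta_eq_thetaConst 98 (by norm_num)] at this
      push_cast at this ⊢
      exact this

lemma mdifferentiable_of_eq {f : ℍ → ℂ} (g : ℂ → ℂ) (hfg : ∀ τ : ℍ, f τ = g τ)
    (hg : ∀ z : ℂ, 0 < z.im → DifferentiableAt ℂ g z) : MDifferentiable 𝓘(ℂ) 𝓘(ℂ) f := by
  rw [UpperHalfPlane.mdifferentiable_iff]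
  refine DifferentiableOn.congr (f := g) (fun z hz ↦ (hg z hz).differentiableWithinAt) fun z hz ↦ ?_
  rw [Function.comp_apply, ofComplex_apply_of_im_pos hz, hfg]

lemma mdifferentiable_etaQuot (r : ℕ → ℤ) : MDifferentiable 𝓘(ℂ) 𝓘(ℂ) (etaQuot r) :=
  mdifferentiable_of_eq (etaQuotC r) (etaQuot_eq_etaQuotC r) fun _ ↦ differentiableAt_etaQuotC r

/-- Multiplication by `q^(m/N)` with `2πm/N ≥ C` makes the function bounded at `i∞` and keeps its
period; the ordinary `q`-expansion is then shifted by `-m`. -/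
lemma exists_hasSum_of_growth {G : ℍ → ℂ} (hG : MDifferentiable 𝓘(ℂ) 𝓘(ℂ) G) {N : ℕ} (hN : 0 < N)
    (hper : ∀ τ : ℍ, G ((N : ℝ) +ᵥ τ) = G τ) {C : ℝ}
    (hC : ∀ τ : ℍ, 1 ≤ τ.im → ‖G τ‖ ≤ Real.exp (C * τ.im)) :
    ∃ (n₀ : ℤ) (a : ℕ → ℂ), ∀ τ : ℍ,
      HasSum (fun n : ℕ ↦ a n * qPow (((n₀ : ℂ) + (n : ℂ)) / (N : ℂ)) τ) (G τ) := by
  have hN' : (0 : ℝ) < N := by exact_mod_cast hN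
  have hNC : (N : ℂ) ≠ 0 := by exact_mod_cast hN.ne'
  obtain ⟨m, hm⟩ := exists_nat_ge (C * N / (2 * π))
  have hm' : C ≤ 2 * π * (m / N) := by
    rw [div_le_iff₀ (by positivity)] at hm
    rw [mul_div_assoc', le_div_iff₀ hN']
    linarith
  set H : ℍ → ℂ := fun τ ↦ qPow ((m / N : ℝ) : ℂ) τ * G τ with hH
  have hHol : MDifferentiable 𝓘(ℂ) 𝓘(ℂ) H := by
    have : MDifferentiable 𝓘(ℂ) 𝓘(ℂ) (qPow ((m / N : ℝ) : ℂ)) :=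
      mdifferentiable_of_eq (fun z ↦ Complex.exp (2 * π * Complex.I * ((m / N : ℝ) : ℂ) * z))
        (fun _ ↦ rfl) fun z _ ↦ by fun_prop
    exact this.mul hG
  have hHper : Function.Periodic (H ∘ ofComplex) (N : ℝ) := by
    intro w
    by_cases hw : 0 < w.im
    · have hw' : 0 < (w + (N : ℝ)).im := by simpa using hw
      have heq : (⟨w + (N : ℝ), hw'⟩ : ℍ) = (N : ℝ) +ᵥ ⟨w, hw⟩ := by
        ext; simp [add_comm]
      rw [Function.comp_apply, Function.comp_apply, ofComplex_apply_of_im_pos hw,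
        ofComplex_apply_of_im_pos hw', heq]
      simp only [hH, hper]
      congr 1
      rw [qPow, qPow, coe_vadd, mul_add, Complex.exp_add]
      have : Complex.exp (2 * π * Complex.I * ((m / N : ℝ) : ℂ) * ((N : ℝ) : ℂ)) = 1 := by
        rw [← Complex.exp_int_mul_two_pi_mul_I m]
        congr 1
        push_cast
        field_simp
      rw [this, one_mul]
    · have hw' : (w + (N : ℝ)).im ≤ 0 := by simpa using hw
      rw [Function.comp_apply, Function.comp_apply, ofComplex_apply_of_im_nonpos (not_lt.mp hw),
        ofComplex_apply_of_im_nonpos hw']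
  have hHbdd : IsBoundedAtImInfty H := by
    rw [isBoundedAtImInfty_iff]
    refine ⟨1, 1, fun z hz ↦ ?_⟩
    rw [hH, norm_mul, norm_qPow]
    refine (mul_le_mul_of_nonneg_left (hC z hz) (Real.exp_pos _).le).trans ?_
    rw [← Real.exp_add, Real.exp_le_one_iff]
    nlinarith [mul_le_mul_of_nonneg_right hm' z.im_pos.le]
  refine ⟨-m, fun n ↦ (qExpansion (N : ℝ) H).coeff n, fun τ ↦ ?_⟩
  have h := (hasSum_qExpansion hN' hHper hHol hHbdd τ).mul_left (qPow (-(m / N : ℝ) : ℝ) τ)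
  have h0 : ∀ x y : ℂ, qPow x τ * qPow y τ = qPow (x + y) τ := fun x y ↦ by
    rw [qPow, qPow, qPow, ← Complex.exp_add]; congr 1; ring
  have hcoeff : ∀ n : ℕ, (qExpansion (N : ℝ) H).coeff n * qPow ((((-m : ℤ) : ℂ) + n) / N) τ =
      qPow (-(m / N : ℝ) : ℝ) τ *
        ((qExpansion (N : ℝ) H).coeff n • Function.Periodic.qParam (N : ℝ) τ ^ n) := by
    intro n
    have : Function.Periodic.qParam (N : ℝ) τ ^ n = qPow (n / N) τ := by
      rw [Function.Periodic.qParam, qPow, ← Complex.exp_nat_mul]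
      congr 1; push_cast; ring
    rw [smul_eq_mul, mul_left_comm, this, h0]
    congr 2; push_cast; ring
  have hval : qPow (-(m / N : ℝ) : ℝ) τ * H τ = G τ := by
    rw [hH, ← mul_assoc, h0, qPow]
    push_cast
    simp
  rw [← hval]
  simp only [hcoeff]
  exact h

/-- In the strip `1 ≤ |j| ≤ K·Im τ`, so `Im(Bτ) = Im τ/|j|²` lies between `1/(K² Im τ)` and `Im τ`,
and controlled growth becomes an exponential bound. -/
lemma exists_norm_smul_le (r : ℕ → ℤ) (B : SL(2, ℤ)) (N : ℝ) (hN : 0 ≤ N) : ∃ C : ℝ, ∀ τ : ℍ,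
    1 ≤ τ.im → |τ.re| ≤ N →
      ‖autFactor B τ ^ (-(1 / 2) : ℂ) * etaQuot r (B • τ)‖ ≤ Real.exp (C * τ.im) := by
  obtain ⟨C, hC⟩ := controlledGrowth_etaQuot r
  set K : ℝ := |((B 1 0 : ℤ) : ℝ)| * (N + 1) + |((B 1 1 : ℤ) : ℝ)| with hK
  refine ⟨|C| * (1 + K ^ 2), fun τ hτ hre ↦ ?_⟩
  have hy := τ.im_pos
  have hj := autFactor_ne_zero B τ
  have hj1 : 1 ≤ ‖autFactor B τ‖ := by
    by_cases hc : B 1 0 = 0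
    · have hd : B 1 1 ≠ 0 := by
        intro hd; have := det_eq_one B; rw [hc, hd] at this; simp at this
      rw [autFactor, hc, Int.cast_zero, zero_mul, zero_add, Complex.norm_intCast]
      exact_mod_cast Int.one_le_abs hd
    · have h1 : (autFactor B τ).im = ((B 1 0 : ℤ) : ℝ) * τ.im := by simp [autFactor]
      have h2 := Complex.abs_im_le_norm (autFactor B τ)
      rw [h1, abs_mul, abs_of_pos hy] at h2
      have h3 : (1 : ℝ) ≤ |((B 1 0 : ℤ) : ℝ)| := by exact_mod_cast Int.one_le_abs hc
      nlinarith
  have hj2 : ‖autFactor B τ‖ ≤ K * τ.im := by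
    have hn : ‖(τ : ℂ)‖ ≤ N + τ.im := by
      have := Complex.norm_le_abs_re_add_abs_im (τ : ℂ)
      simp only [coe_re, coe_im, abs_of_pos hy] at this
      linarith
    rw [autFactor]
    refine (norm_add_le _ _).trans ?_
    rw [norm_mul, Complex.norm_intCast, Complex.norm_intCast, hK, add_mul, mul_assoc]
    refine add_le_add (mul_le_mul_of_nonneg_left (hn.trans ?_) (abs_nonneg _)) ?_
    · nlinarith
    · exact le_mul_of_one_le_right (abs_nonneg _) hτ
  have him : (B • τ).im = τ.im / ‖autFactor B τ‖ ^ 2 := by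
    have h := ModularGroup.im_smul_eq_div_normSq B τ
    rw [Complex.normSq_eq_norm_sq] at h
    rw [h]
    simp [autFactor, denom]
  have hn1 : ‖autFactor B τ ^ (-(1 / 2) : ℂ)‖ ≤ 1 := by
    have h := cpow_half_sq (autFactor B τ)
    have h2 : ‖autFactor B τ ^ (1 / 2 : ℂ)‖ ^ 2 = ‖autFactor B τ‖ := by rw [← norm_pow, h]
    rw [Complex.cpow_neg, norm_inv]
    refine inv_le_one_of_one_le₀ ?_
    by_contra hlt
    rw [not_le] at hlt
    have := norm_nonneg (autFactor B τ ^ (1 / 2 : ℂ))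
    nlinarith
  obtain ⟨hne, hlog⟩ := hC (B • τ)
  have hF : ‖etaQuot r (B • τ)‖ ≤ Real.exp (|C| * (1 + K ^ 2) * τ.im) := by
    rw [← Real.log_le_iff_le_exp (norm_pos_iff.mpr hne)]
    refine (le_abs_self _).trans (hlog.trans ?_)
    have hj0 : 0 < ‖autFactor B τ‖ := norm_pos_iff.mpr hj
    have b1 : (B • τ).im ≤ τ.im := by
      rw [him]
      exact div_le_self hy.le (one_le_pow₀ hj1)
    have b2 : 1 / (B • τ).im ≤ K ^ 2 * τ.im := by
      rw [him, one_div_div, div_le_iff₀ hy]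
      calc ‖autFactor B τ‖ ^ 2 ≤ (K * τ.im) ^ 2 := by gcongr
        _ = _ := by ring
    have b3 : 0 ≤ (B • τ).im + 1 / (B • τ).im := by
      have := (B • τ).im_pos
      positivity
    calc C * ((B • τ).im + 1 / (B • τ).im) ≤ |C| * ((B • τ).im + 1 / (B • τ).im) :=
          mul_le_mul_of_nonneg_right (le_abs_self C) b3
      _ ≤ |C| * (τ.im + K ^ 2 * τ.im) := by gcongr
      _ = _ := by ring
  rw [norm_mul]
  calc _ ≤ 1 * Real.exp (|C| * (1 + K ^ 2) * τ.im) := by gcongr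
    _ = _ := one_mul _

/-- The quotient of the roots has argument in `(-π/2, π/2)`, so it is the principal root of its
square. -/
lemma cpow_half_div {x y : ℂ} (hx : x ≠ 0) (hy : y ≠ 0) (h : |x.arg - y.arg| < π) :
    (x / y) ^ (1 / 2 : ℂ) = x ^ (1 / 2 : ℂ) / y ^ (1 / 2 : ℂ) := by
  have h1 : x / y = (x ^ (1 / 2 : ℂ) / y ^ (1 / 2 : ℂ)) ^ 2 := by
    rw [div_pow, cpow_half_sq, cpow_half_sq]
  have h2 : 0 < (x ^ (1 / 2 : ℂ) / y ^ (1 / 2 : ℂ)).re := by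
    rw [Complex.cpow_def_of_ne_zero hx, Complex.cpow_def_of_ne_zero hy, ← Complex.exp_sub,
      Complex.exp_re]
    refine mul_pos (Real.exp_pos _) (Real.cos_pos_of_mem_Ioo ?_)
    have h3 : (Complex.log x * (1 / 2) - Complex.log y * (1 / 2)).im = (x.arg - y.arg) / 2 := by
      rw [← sub_mul, show (1 / 2 : ℂ) = ((1 / 2 : ℝ) : ℂ) by push_cast; rfl, Complex.im_mul_ofReal]
      simp [Complex.log_im]
      ring
    rw [h3]
    rw [abs_lt] at h
    constructor <;> linarith [h.1, h.2]
  conv_lhs => rw [h1]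
  have := Complex.sq_cpow_two_inv h2
  rwa [← one_div] at this

/-- The values of `cτ + d` stay in one open half-plane, or are constant when `c = 0`. -/
lemma abs_arg_autFactor_sub_lt (B : SL(2, ℤ)) (τ σ : ℍ) :
    |(autFactor B τ).arg - (autFactor B σ).arg| < π := by
  have him : ∀ τ : ℍ, (autFactor B τ).im = ((B 1 0 : ℤ) : ℝ) * τ.im := fun τ ↦ by simp [autFactor]
  rcases lt_trichotomy (B 1 0) 0 with hc | hc | hc
  · have h : ∀ τ : ℍ, (autFactor B τ).arg ∈ Set.Ioo (-π) 0 := fun τ ↦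
      ⟨Complex.neg_pi_lt_arg _, Complex.arg_neg_iff.mpr (by
        rw [him]; exact mul_neg_of_neg_of_pos (by exact_mod_cast hc) τ.im_pos)⟩
    rw [abs_lt]
    constructor <;> linarith [(h τ).1, (h τ).2, (h σ).1, (h σ).2]
  · simp [autFactor, hc, Real.pi_pos]
  · have h : ∀ τ : ℍ, (autFactor B τ).arg ∈ Set.Ioo 0 π := fun τ ↦
      arg_mem_Ioo_of_im_pos (by rw [him]; exact mul_pos (by exact_mod_cast hc) τ.im_pos)
    rw [abs_lt]
    constructor <;> linarith [(h τ).1, (h τ).2, (h σ).1, (h σ).2]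

lemma Gamma_le_of_dvd {N : ℕ} (hN : 784 ∣ N) : Gamma N ≤ Gamma1 28 ⊓ Gamma0 784 := by
  intro A hA
  have h28 : 28 ∣ N := dvd_trans (by norm_num) hN
  have hmap : ∀ {M : ℕ}, M ∣ N → ∀ x y : ℤ, (x : ZMod N) = y → (x : ZMod M) = y := by
    intro M hM x y h
    rw [ZMod.intCast_eq_intCast_iff_dvd_sub] at h ⊢
    exact dvd_trans (by exact_mod_cast hM) h
  rw [Gamma_mem] at hA
  obtain ⟨h00, -, h10, h11⟩ := hA
  rw [Subgroup.mem_inf, Gamma1_mem, Gamma0_mem]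
  refine ⟨⟨?_, ?_, ?_⟩, ?_⟩
  · exact_mod_cast hmap h28 _ 1 (by exact_mod_cast h00)
  · exact_mod_cast hmap h28 _ 1 (by exact_mod_cast h11)
  · exact_mod_cast hmap h28 _ 0 (by exact_mod_cast h10)
  · exact_mod_cast hmap hN _ 0 (by exact_mod_cast h10)

/-- Periodicity up to sign of the expansion of the eta quotient at a cusp. -/
lemma exists_sign_vadd {F : ℍ → ℂ} (hF : ∀ A ∈ Gamma1 28 ⊓ Gamma0 784, ∀ τ : ℍ, F (A • τ) =
      ((extJacobi (A 1 0) (A 1 1) : ℤ) : ℂ) * autFactor A τ ^ (1 / 2 : ℂ) * F τ) (B : SL(2, ℤ)) :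
    ∃ χ : ℂ, χ ^ 2 = 1 ∧ ∀ τ : ℍ,
      autFactor B ((784 : ℝ) +ᵥ τ) ^ (-(1 / 2) : ℂ) * F (B • ((784 : ℝ) +ᵥ τ)) =
        χ * (autFactor B τ ^ (-(1 / 2) : ℂ) * F (B • τ)) := by
  have hT : ModularGroup.T ^ (784 : ℤ) ∈ Gamma 784 := by
    rw [Gamma_mem, ModularGroup.coe_T_zpow]
    simp only [Matrix.of_apply, Matrix.cons_val', Matrix.cons_val_zero, Matrix.cons_val_one,
      Matrix.cons_val_fin_one]
    refine ⟨by simp, ?_, by simp, by simp⟩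
    exact_mod_cast ZMod.natCast_self 784
  -- Normality of `Γ(784)` puts this conjugate in the group, so translation by 784 becomes the
  -- action of `A` at `Bτ`.
  set A := B * ModularGroup.T ^ (784 : ℤ) * B⁻¹ with hAdef
  have hA : A ∈ Gamma1 28 ⊓ Gamma0 784 :=
    Gamma_le_of_dvd dvd_rfl ((Gamma_normal 784).conj_mem _ hT B)
  have hcop : IsCoprime (A 1 0) (A 1 1) := ⟨-A 0 1, A 0 0, by linarith [det_eq_one A]⟩
  refine ⟨((extJacobi (A 1 0) (A 1 1) : ℤ) : ℂ), by exact_mod_cast extJacobi_sq hcop, fun τ ↦ ?_⟩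
  have hAB : A * B = B * ModularGroup.T ^ (784 : ℤ) := by rw [hAdef, inv_mul_cancel_right]
  have hvadd : (784 : ℝ) +ᵥ τ = ModularGroup.T ^ (784 : ℤ) • τ := by
    rw [modular_T_zpow_smul]; norm_num
  have hTj : autFactor (ModularGroup.T ^ (784 : ℤ)) τ = 1 := by
    rw [autFactor, ModularGroup.coe_T_zpow]; simp
  have hj : autFactor B ((784 : ℝ) +ᵥ τ) = autFactor A (B • τ) * autFactor B τ := by
    rw [← autFactor_mul, hAB, autFactor_mul, hTj, mul_one, hvadd]
  have hpt : B • ((784 : ℝ) +ᵥ τ) = A • B • τ := by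
    rw [hvadd, ← mul_smul, ← mul_smul, hAB]
  have n1 := autFactor_ne_zero B τ
  have n2 := autFactor_ne_zero B ((784 : ℝ) +ᵥ τ)
  have hdiv := cpow_half_div n2 n1 (abs_arg_autFactor_sub_lt B _ _)
  have hq : autFactor A (B • τ) = autFactor B ((784 : ℝ) +ᵥ τ) / autFactor B τ := by
    rw [hj, mul_div_cancel_right₀ _ n1]
  have n3 : autFactor B ((784 : ℝ) +ᵥ τ) ^ (1 / 2 : ℂ) ≠ 0 := fun h ↦
    n2 (by rw [← cpow_half_sq (autFactor B ((784 : ℝ) +ᵥ τ)), h]; ring)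
  rw [hpt, hF A hA, hq, hdiv, Complex.cpow_neg, Complex.cpow_neg]
  field_simp

/-- The sign under translation by 784 squares to 1, hence the period `1568 = 2·784`. -/
lemma exists_hasSum_cusp (r : ℕ → ℤ) (hF : ∀ A ∈ Gamma1 28 ⊓ Gamma0 784, ∀ τ : ℍ,
      etaQuot r (A • τ) =
        ((extJacobi (A 1 0) (A 1 1) : ℤ) : ℂ) * autFactor A τ ^ (1 / 2 : ℂ) * etaQuot r τ)
    (B : SL(2, ℤ)) : ∃ (n₀ : ℤ) (a : ℕ → ℂ), ∀ τ : ℍ,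
      HasSum (fun n : ℕ ↦ a n * qPow (((n₀ : ℂ) + (n : ℂ)) / ((1568 : ℕ) : ℂ)) τ)
        (autFactor B τ ^ (-(1 / 2) : ℂ) * etaQuot r (B • τ)) := by
  set G : ℍ → ℂ := fun τ ↦ autFactor B τ ^ (-(1 / 2) : ℂ) * etaQuot r (B • τ) with hG
  obtain ⟨χ, hχ, hsign⟩ := exists_sign_vadd hF B
  have hper : ∀ τ : ℍ, G ((1568 : ℝ) +ᵥ τ) = G τ := by
    intro τ
    rw [show (1568 : ℝ) = 784 + 784 by norm_num, add_vadd]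
    simp only [hG, hsign]
    rw [← mul_assoc, ← sq, hχ, one_mul]
  have hhol : MDifferentiable 𝓘(ℂ) 𝓘(ℂ) G := by
    have hden : ∀ z : ℂ, 0 < z.im → ((B 1 0 : ℤ) : ℂ) * z + (B 1 1 : ℤ) ≠ 0 := fun z hz ↦
      autFactor_ne_zero B ⟨z, hz⟩
    refine mdifferentiable_of_eq (fun z ↦ (((B 1 0 : ℤ) : ℂ) * z + (B 1 1 : ℤ)) ^ (-(1 / 2) : ℂ) *
      etaQuotC r ((((B 0 0 : ℤ) : ℂ) * z + (B 0 1 : ℤ)) / (((B 1 0 : ℤ) : ℂ) * z + (B 1 1 : ℤ))))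
      (fun τ ↦ ?_) fun z hz ↦ DifferentiableAt.mul ?_ ?_
    · simp only [hG, etaQuot_eq_etaQuotC, coe_smul_eq, autFactor]
    · rcases eq_or_ne (B 1 0) 0 with hc | hc
      · simp only [hc, Int.cast_zero, zero_mul, zero_add]
        fun_prop
      · refine DifferentiableAt.cpow_const (by fun_prop) (Or.inr ?_)
        simp [hc, hz.ne']
    · have him : 0 < ((((B 0 0 : ℤ) : ℂ) * z + (B 0 1 : ℤ)) /
          (((B 1 0 : ℤ) : ℂ) * z + (B 1 1 : ℤ))).im := by
        have := (B • (⟨z, hz⟩ : ℍ)).im_pos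
        rwa [← coe_im, coe_smul_eq] at this
      have h0 := hden z hz
      exact DifferentiableAt.comp (g := etaQuotC r) (f := fun z : ℂ ↦
        (((B 0 0 : ℤ) : ℂ) * z + (B 0 1 : ℤ)) / (((B 1 0 : ℤ) : ℂ) * z + (B 1 1 : ℤ))) z
        (differentiableAt_etaQuotC r him) (by fun_prop (disch := assumption))
  obtain ⟨C, hC⟩ := exists_norm_smul_le r B 1568 (by norm_num)
  refine exists_hasSum_of_growth hhol (N := 1568) (by norm_num) (by exact_mod_cast hper)
    (C := C) fun τ hτ ↦ ?_
  -- Periodicity moves the real part into `[0, 1568)`, where the strip bound applies.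
  have hperR : Function.Periodic (fun x : ℝ ↦ G (x +ᵥ τ)) 1568 := fun x ↦ by
    simp only
    rw [add_comm, add_vadd, hper]
  have h0 := (hperR.int_mul (-⌊τ.re / 1568⌋)) 0
  simp only [zero_add, zero_vadd] at h0
  rw [← h0]
  have h1 := hC ((((-⌊τ.re / 1568⌋ : ℤ) : ℝ) * 1568) +ᵥ τ) (by rwa [vadd_im]) (by
    rw [vadd_re, abs_le]
    have a1 := Int.floor_le (τ.re / 1568)
    have a2 := Int.lt_floor_add_one (τ.re / 1568)
    rw [le_div_iff₀ (by norm_num)] at a1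
    rw [div_lt_iff₀ (by norm_num)] at a2
    push_cast
    constructor <;> linarith)
  rwa [vadd_im] at h1

end Cusps

end EtaQuotient

end

theorem corollary5p6 (r : ℕ → ℤ) (R S : ℤ)
    (hR : R = r 1 + r 2 + r 3 + r 4 + r 5 + r 6 + r 7)
    (hS : S = r 1 + r 3 + r 5 + r 7)
    (h₁ : r 0 + R = 1)
    (h₂ : r 0 + 3 * R ≡ -3 [ZMOD 24])
    (h₃ : 1 + S ≡ 0 [ZMOD 4]) :
    (∀ A ∈ Gamma1 28 ⊓ Gamma0 784, ∀ τ : ℍ,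
      EtaQuotient.etaQuot r (A • τ) =
        ((EtaQuotient.extJacobi (A 1 0) (A 1 1) : ℤ) : ℂ) *
          EtaQuotient.autFactor A τ ^ (1 / 2 : ℂ) * EtaQuotient.etaQuot r τ) ∧
    EtaQuotient.IsWeaklyHolomorphicHalfIntegral 1 (Gamma1 28 ⊓ Gamma0 784)
      (EtaQuotient.etaQuot r) := by
  have hF : ∀ A ∈ Gamma1 28 ⊓ Gamma0 784, ∀ τ : ℍ, EtaQuotient.etaQuot r (A • τ) =
      ((EtaQuotient.extJacobi (A 1 0) (A 1 1) : ℤ) : ℂ) *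
        EtaQuotient.autFactor A τ ^ (1 / 2 : ℂ) * EtaQuotient.etaQuot r τ :=
    fun A hA τ ↦ EtaQuotient.etaQuot_smul r R S hR hS h₁ h₂ h₃ hA τ
  refine ⟨hF, odd_one, fun A hA ↦ ?_, EtaQuotient.mdifferentiable_etaQuot r, fun A hA τ ↦ ?_,
    1568, by norm_num, EtaQuotient.Gamma_le_of_dvd ⟨2, by norm_num⟩, fun B ↦ ?_⟩
  · have h := (Subgroup.mem_inf.mp hA).2
    rw [Gamma0_mem, ZMod.intCast_zmod_eq_zero_iff_dvd] at h ⊢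
    exact dvd_trans (by norm_num) h
  · have h := (Subgroup.mem_inf.mp hA).1
    rw [Gamma1_mem] at h
    -- On `Γ₁(28)` this makes `ε(δ) = 1`, so the theta multiplier reduces to the Jacobi symbol.
    have hd : A 1 1 ≡ 1 [ZMOD 4] := by
      have h28 : A 1 1 ≡ 1 [ZMOD (28 : ℕ)] := by
        rw [← ZMod.intCast_eq_intCast_iff]; exact_mod_cast h.2.1
      exact h28.of_dvd (by norm_num)
    rw [hF A hA, EtaQuotient.thetaEps, if_pos hd]
    simp
  · have := EtaQuotient.exists_hasSum_cusp r hF B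
    simpa using this
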